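/- Let $c,g,d\ge 1$ be integers and let $P=(P(i,j))_{i,j\in\mathbb N}$ be a Markov kernel on $\mathbb N=\{0,1,2,\dots\}$ such that $\sum_{j=0}^{c}P(i,j)=1$ for $0\le i\le g-1$, and, for $i\ge g$, $P(i,j)=a_{j-i}$ if $i-g\le j\le i+d$ and $P(i,j)=0$ otherwise, where $a_{-g},\dots,a_d\in[0,1]$, $\sum_{k=-g}^d a_k=1$, $a_{-g}>0$ and $a_d>0$. Assume that $\sum_{k=-g}^d k\,a_k<0$ (NERI) and that $P$ is irreducible and aperiodic. Put $\phi(t)=\sum_{k=-g}^d a_kt^k$. There is a unique $\hat\gamma>1$ at which $\phi$ attains its minimum over $(1,\infty)$, and $\hat\delta:=\phi(\hat\gamma)<1$. The kernel $P$ has a unique invariant probability measure $\pi$, and $\sum_n\pi(n)\hat\gamma^{\,n}<\infty$. For $f:\mathbb N\to\mathbb C$ let $\|f\|_{\hat\gamma}=\sup_n\hat\gamma^{-n}|f(n)|$, and let $$\rho_{\hat\gamma}(P)=\inf\Big\{\rho\in(0,1):\ \sup_{\|f\|_{\hat\gamma}\le1}\|P^nf-\pi(f)\mathbf 1\|_{\hat\gamma}=O(\rho^n)\Big\}.$$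 Let $\Lambda=\{\lambda\in\mathbb C:\hat\delta<|\lambda|<1\}$ and $E_\lambda(z)=z^g(\phi(z)-\lambda)=\sum_{k=-g}^d a_kz^{g+k}-\lambda z^g$. For $\lambda\in\Lambda$ let $\mathcal E_\lambda^-$ be the set of complex roots $z$ of $E_\lambda$ with $|z|<\hat\gamma$, and $m_z$ the multiplicity of $z$ as a root of $E_\lambda$. There is an integer $\eta\ge1$ such that $\sum_{z\in\mathcal E_\lambda^-}m_z=\eta$ for every $\lambda\in\Lambda$. For $k\ge1$ put $z^{(k)}(n)=n(n-1)\cdots(n-k+2)\,z^{n-k+1}$ (so $z^{(1)}(n)=z^n$). Condition (ii) on $\lambda\in\Lambda$ is: there is a nonzero family $(\alpha_{z,k})_{z\in\mathcal E_\lambda^-,\,1\le k\le m_z}$ of complex numbers such that $f=\sum_{z\in\mathcal E_\lambda^-}\sum_{k=1}^{m_z}\alpha_{z,k}z^{(k)}$ satisfies $\lambda f(i)=(Pf)(i)$ for $i=0,\dots,g-1$. Elimination polynomials. Let $\mathcal M$ be the finite set of tuples $\mu=(m_1,\dots,m_s)$, $1\le s\le\eta$, of positive integers with $m_1\le\dots\le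 m_s$ and $\sum_i m_i=\eta$, and let $\ell=\binom g\eta$. For $\mu\in\mathcal M$ and indeterminates $\lambda,z_1,\dots,z_s$, consider the $g\times\eta$ matrix whose row $b\in\{0,\dots,g-1\}$ and column $(i,k)$, $1\le i\le s$, $1\le k\le m_i$, has the entry $\sum_{j=0}^cP(b,j)z_i^{(k)}(j)-\lambda z_i^{(k)}(b)$. Divide each of its $\ell$ maximal minors by $\prod_{1\le i<j\le s}(z_i-z_j)^{\min(m_i,m_j)}$ (the division is exact) to get polynomials $P_{0,\mu,k}(\lambda,z_1,\dots,z_s)$, $1\le k\le\ell$, and let $$\mathcal R_{\mu,k}(\lambda)=\mathrm{Res}_{z_1}\big(\cdots\mathrm{Res}_{z_{s-1}}(\mathrm{Res}_{z_s}(P_{0,\mu,k},E_\lambda(z_s)),E_\lambda(z_{s-1}))\cdots,E_\lambda(z_1)\big).$$ Let $\Lambda_\mu=\{\lambda\in\Lambda:\mathcal R_{\mu,1}(\lambda)=\dots=\mathcal R_{\mu,\ell}(\lambda)=0\}$, and let $\mathcal Z$ be the set of all $\lambda\in\bigcup_{\mu\in\mathcal M}\Lambda_\mu$ that satisfy condition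 (ii). Then $\mathcal Z$ is a finite (possibly empty) set, the set defining $\rho_{\hat\gamma}(P)$ is nonempty, and $$\rho_{\hat\gamma}(P)=\max\big(\hat\delta,\ \max\{|\lambda|:\lambda\in\mathcal Z\}\big),$$ where the right-hand side is read as $\hat\delta$ if $\mathcal Z=\emptyset$. -/

import Mathlib

open Polynomial

noncomputable section

namespace RW

/-! ### Kernels on `ℕ` -/

/-- `P = (P(i,j))` is a Markov kernel on `ℕ`. -/
def IsMarkov (P : ℕ → ℕ → ℝ) : Prop :=
  (∀ i j, 0 ≤ P i j) ∧ ∀ i, HasSum (P i) 1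

/-- The `n`-step transition probabilities `P^n(i,j)`. -/
def step (P : ℕ → ℕ → ℝ) : ℕ → ℕ → ℕ → ℝ
  | 0, i, j => if i = j then 1 else 0
  | n + 1, i, j => ∑' k, P i k * step P n k j

/-- Irreducibility: every state is reached from every state with positive probability. -/
def IsIrreducible (P : ℕ → ℕ → ℝ) : Prop :=
  ∀ i j, ∃ n, 0 < step P n i j

/-- Aperiodicity: for every state `i`, the gcd of `{n ≥ 1 : P^n(i,i) > 0}` is `1`. -/
def IsAperiodic (P : ℕ → ℕ → ℝ) : Prop :=
  ∀ i p : ℕ, (∀ n, 1 ≤ n → 0 < step P n i i → p ∣ n) → p = 1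

/-- The action `(P f)(i) = ∑_j P(i,j) f(j)` on complex sequences. -/
def act (P : ℕ → ℕ → ℝ) (f : ℕ → ℂ) (i : ℕ) : ℂ := ∑' j, (P i j : ℂ) * f j

/-- `π` is an invariant probability measure of `P`. -/
def IsInvariantProb (P : ℕ → ℕ → ℝ) (π : ℕ → ℝ) : Prop :=
  (∀ i, 0 ≤ π i) ∧ HasSum π 1 ∧ ∀ j, HasSum (fun i => π i * P i j) (π j)

/-- The set of `ρ ∈ (0,1)` such that `sup_{‖f‖_V ≤ 1} ‖P^n f - π(f) 1‖_V = O(ρ^n)`, where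
`‖f‖_V = sup_i |f i| / V i` (with `V > 0`). -/
def rateSet (P : ℕ → ℕ → ℝ) (π V : ℕ → ℝ) : Set ℝ :=
  {ρ | 0 < ρ ∧ ρ < 1 ∧ ∃ C : ℝ, ∀ᶠ n : ℕ in Filter.atTop,
    ∀ f : ℕ → ℂ, (∀ i, ‖f i‖ ≤ V i) →
      ∀ i, ‖(act P)^[n] f i - ∑' j, (π j : ℂ) * f j‖ ≤ C * ρ ^ n * V i}

/-- The convergence rate `ρ_V(P)`. -/
def rate (P : ℕ → ℕ → ℝ) (π V : ℕ → ℝ) : ℝ := sInf (rateSet P π V)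

/-! ### Random walks with i.d. bounded increments -/

/-- `P` is the kernel of a random walk on `ℕ` with identically distributed bounded increments:
from `i ≥ g` the increment has law `(a_{-g}, …, a_d)` with `a_{-g}, a_d > 0`, and from the
boundary states `0, …, g-1` the walk jumps into `{0, …, c}`. Only the values of `a` on
`{-g, …, d}` matter. -/
structure IsWalk (P : ℕ → ℕ → ℝ) (c g d : ℕ) (a : ℤ → ℝ) : Prop where
  c_pos : 1 ≤ c
  g_pos : 1 ≤ g
  d_pos : 1 ≤ d
  markov : IsMarkov P
  boundary : ∀ i < g, ∑ j ∈ Finset.range (c + 1), P i j = 1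
  interior : ∀ i j : ℕ, g ≤ i →
    P i j = if (i : ℤ) - g ≤ j ∧ (j : ℤ) ≤ i + d then a ((j : ℤ) - i) else 0
  a_mem : ∀ k ∈ Finset.Icc (-(g : ℤ)) d, a k ∈ Set.Icc (0 : ℝ) 1
  a_left : 0 < a (-(g : ℤ))
  a_right : 0 < a d
  a_sum : ∑ k ∈ Finset.Icc (-(g : ℤ)) d, a k = 1

/-- `φ(t) = ∑_{k=-g}^d a_k t^k`. -/
def phi (g d : ℕ) (a : ℤ → ℝ) (t : ℝ) : ℝ := ∑ k ∈ Finset.Icc (-(g : ℤ)) d, a k * t ^ k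

/-- `γ > 1` and `φ(γ) = min_{(1,∞)} φ`. -/
def IsMinimizer (g d : ℕ) (a : ℤ → ℝ) (γ : ℝ) : Prop :=
  1 < γ ∧ IsMinOn (phi g d a) (Set.Ioi 1) γ

/-- `E_λ(z) = z^g (φ(z) - λ) = ∑_{k=-g}^d a_k z^{g+k} - λ z^g`, as a polynomial in `z`, for `lam`
in any real algebra `A` (a complex number, or an indeterminate). -/
def charPoly (g d : ℕ) (a : ℤ → ℝ) {A : Type*} [CommRing A] [Algebra ℝ A] (lam : A) : A[X] :=
  ∑ k ∈ Finset.Icc (-(g : ℤ)) d, C (algebraMap ℝ A (a k)) * X ^ (g + k).toNat - C lam * X ^ g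

/-- `Λ = {λ ∈ ℂ : φ(γ) < |λ| < 1}`. -/
def annulus (g d : ℕ) (a : ℤ → ℝ) (γ : ℝ) : Set ℂ := {lam | phi g d a γ < ‖lam‖ ∧ ‖lam‖ < 1}

open Classical in
/-- `E_λ^- = {z ∈ ℂ : E_λ(z) = 0, |z| < γ}`. -/
def smallRoots (g d : ℕ) (a : ℤ → ℝ) (γ : ℝ) (lam : ℂ) : Finset ℂ :=
  (charPoly g d a lam).roots.toFinset.filter fun z => ‖z‖ < γ

/-- The multiplicity `m_z` of `z` as a root of `E_λ`. -/
def mult (g d : ℕ) (a : ℤ → ℝ) (lam z : ℂ) : ℕ := (charPoly g d a lam).rootMultiplicity z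

/-- `N(λ)`: number of roots of `E_λ` of modulus `< γ`, with multiplicity. -/
def numSmall (g d : ℕ) (a : ℤ → ℝ) (γ : ℝ) (lam : ℂ) : ℕ :=
  ∑ z ∈ smallRoots g d a γ lam, mult g d a lam z

/-- For `k ≥ 1`, the sequence `z^{(k)}(n) = n(n-1)⋯(n-k+2) z^{n-k+1}` (so `z^{(1)}(n) = z^n`). -/
def zseq {A : Type*} [CommRing A] (z : A) (k n : ℕ) : A :=
  (n.descFactorial (k - 1) : A) * z ^ (n - (k - 1))

/-- The condition characterising eigenvalues: there is a nonzero family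
`α_{z,k}` (`z ∈ E_λ^-`, `1 ≤ k ≤ m_z`) such that `f = ∑_z ∑_k α_{z,k} z^{(k)}` satisfies the boundary
equations `λ f(i) = (P f)(i)`, `0 ≤ i ≤ g-1`. -/
def BoundaryCondition (P : ℕ → ℕ → ℝ) (g d : ℕ) (a : ℤ → ℝ) (γ : ℝ) (lam : ℂ) : Prop :=
  ∃ α : ℂ → ℕ → ℂ,
    (∃ z ∈ smallRoots g d a γ lam, ∃ k ∈ Finset.Icc 1 (mult g d a lam z), α z k ≠ 0) ∧
    ∀ i < g,
      lam * (fun n => ∑ z ∈ smallRoots g d a γ lam, ∑ k ∈ Finset.Icc 1 (mult g d a lam z),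
          α z k * zseq z k n) i =
        act P (fun n => ∑ z ∈ smallRoots g d a γ lam, ∑ k ∈ Finset.Icc 1 (mult g d a lam z),
          α z k * zseq z k n) i

/-! ### Elimination polynomials

The indeterminate `λ` is `X : ℂ[X]`; the indeterminates `z_1, …, z_s` are the variables of
`MvPolynomial (Fin s) ℂ[X]`. -/

/-- The set `M` of multiplicity patterns `μ = (m_1, …, m_s)`: positive nondecreasing tuples of
sum `η`, of some length `s ≥ 1`. -/
def patterns (η : ℕ) : Set (Σ s : ℕ, Fin s → ℕ) :=
  {μ | 1 ≤ μ.1 ∧ (∀ i, 1 ≤ μ.2 i) ∧ Monotone μ.2 ∧ ∑ i, μ.2 i = η}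

/-- The coefficient `(P z^{(k)})(b) - λ z^{(k)}(b)` of an unknown `α_{z,k}` in the boundary
equation with index `b < g`. -/
def boundaryCoeff (P : ℕ → ℕ → ℝ) (c : ℕ) {A : Type*} [CommRing A] [Algebra ℝ A]
    (lam z : A) (k b : ℕ) : A :=
  ∑ j ∈ Finset.range (c + 1), algebraMap ℝ A (P b j) * zseq z k j - lam * zseq z k b

/-- The minor of the boundary linear system (unknowns `α_{i,k}`, `1 ≤ i ≤ s`, `1 ≤ k ≤ m_i`)
made of the `η = m_1 + ⋯ + m_s` boundary equations selected by `r`. There are `g.choose η`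
increasing selections `r`. -/
def minor (P : ℕ → ℕ → ℝ) (c g : ℕ) {s : ℕ} (m : Fin s → ℕ) (r : Fin (∑ i, m i) ↪o Fin g) :
    MvPolynomial (Fin s) ℂ[X] :=
  Matrix.det (Matrix.of fun p q : (Σ i : Fin s, Fin (m i)) =>
    boundaryCoeff P c (MvPolynomial.C X) (MvPolynomial.X q.1) (q.2 + 1) (r (finSigmaFinEquiv p)))

/-- `∏_{i<j} (z_i - z_j)^{min(m_i, m_j)}`. -/
def diffProd {s : ℕ} (m : Fin s → ℕ) : MvPolynomial (Fin s) ℂ[X] :=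
  ∏ i, ∏ j ∈ Finset.Ioi i, (MvPolynomial.X i - MvPolynomial.X j) ^ min (m i) (m j)

open Classical in
/-- The exact quotient `p / q` in a commutative domain (unique for `q ≠ 0` dividing `p`; by
convention it is `p` when `q` does not divide `p`). -/
def exactQuot {A : Type*} [CommRing A] (p q : A) : A :=
  if h : q ∣ p then h.choose else p

/-- The polynomial `P_{0,μ,r}(λ, z_1, …, z_s)`: the minor divided by `diffProd m`. The division is
exact, since the `k`-th column of the minor attached to `z_i` is the `(k-1)`-st derivative at `z_i`
of one and the same polynomial vector. -/
def reducedMinor (P : ℕ → ℕ → ℝ) (c g : ℕ) {s : ℕ} (m : Fin s → ℕ)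
    (r : Fin (∑ i, m i) ↪o Fin g) : MvPolynomial (Fin s) ℂ[X] :=
  exactQuot (minor P c g m r) (diffProd m)

/-- Successive elimination of `z_s, …, z_1` by resultants with `E_λ`:
`Res_{z_1}(⋯ Res_{z_s}(p, E_λ) ⋯, E_λ)`, a polynomial in `λ`. -/
def eliminate (g d : ℕ) (a : ℤ → ℝ) : (s : ℕ) → MvPolynomial (Fin s) ℂ[X] → ℂ[X]
  | 0, p => MvPolynomial.isEmptyAlgEquiv ℂ[X] (Fin 0) p
  | s + 1, p => eliminate g d a s
      (resultant
        (MvPolynomial.optionEquivLeft ℂ[X] (Fin s) (MvPolynomial.rename finSuccEquivLast p))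
        (charPoly g d a (MvPolynomial.C X : MvPolynomial (Fin s) ℂ[X])))

/-- The elimination polynomial `R_{μ,r}(λ)`. -/
def elimPoly (P : ℕ → ℕ → ℝ) (c g d : ℕ) (a : ℤ → ℝ) (μ : Σ s : ℕ, Fin s → ℕ)
    (r : Fin (∑ i, μ.2 i) ↪o Fin g) : ℂ[X] :=
  eliminate g d a μ.1 (reducedMinor P c g μ.2 r)

/-- `Λ_μ`: common zeros in `Λ` of the polynomials `R_{μ,r}`. -/
def annulusZeros (P : ℕ → ℕ → ℝ) (c g d : ℕ) (a : ℤ → ℝ) (γ : ℝ) (μ : Σ s : ℕ, Fin s → ℕ) :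
    Set ℂ :=
  {lam ∈ annulus g d a γ | ∀ r, (elimPoly P c g d a μ r).eval lam = 0}

/-- The set `Z` of the `λ ∈ ⋃_{μ ∈ M} Λ_μ` for which the boundary condition holds. -/
def candidates (P : ℕ → ℕ → ℝ) (c g d : ℕ) (a : ℤ → ℝ) (γ : ℝ) (η : ℕ) : Set ℂ :=
  {lam ∈ ⋃ μ ∈ patterns η, annulusZeros P c g d a γ μ | BoundaryCondition P g d a γ lam}

end RW

end

noncomputable section

namespace RW

/-! ### The minimum of `φ` -/

section Minimizer

variable {g d : ℕ} {a : ℤ → ℝ}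

/-! Fix $\gamma>1$ with $\varphi(\gamma)<1$; that $\gamma$ is the minimizer matters only for its
uniqueness, which is strict convexity. On sequences $O(\gamma^n)$, write $P=T+{}$finite rank, where
$T$ is $P$ with the boundary rows $0,\dots,g-1$ replaced by zero. Since $\sum_k
a_k\gamma^{i+k}=\varphi(\gamma)\gamma^i$, one has $\|T\|\le\varphi(\gamma)$, so $\lambda-T$ is
invertible for $|\lambda|>\varphi(\gamma)$, and in that region only eigenvalues of $P$ can occur in
the spectrum.

The interior equations $(Pf)(i)=\lambda f(i)$, $i\ge g$, are solved in two ways. By the resolvent of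
$T$, a solution that is $O(\gamma^n)$ is determined freely by its $g$ boundary values. By the
recurrence $E_\lambda(S)f=0$ in the shift $S$, the roots outside the disc drop out and the $z^{(k)}$
with $|z|<\gamma$ are independent solutions. Comparing dimensions (`IsWalk.numSmall_eq`) gives
$\eta=g$ without any contour argument and shows that the $z^{(k)}$ form a basis, so condition (ii)
says exactly that $\lambda$ is an eigenvalue of $P$ (`IsWalk.boundaryCondition_iff`). For such
$\lambda$ the boundary system is singular, its minors vanish at the actual roots, and resultants
preserve this; hence $\mathcal Z$ is the set of eigenvalues in the annulus (`IsWalk.candidates_eq`).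

Finiteness: the eigenvalues are the zeros of a determinant, holomorphic on
$|\lambda|>\varphi(\gamma)$. Zeros could a priori accumulate at the inner circle; this is excluded
because the determinant is integral over $\mathbb C[\lambda]$ (`IsWalk.exists_monic_relation`,
`finite_zeros_of_monic_relation`).

Rate, upper bound: $P-\pi(\cdot)\mathbf 1$ is again a finite-rank perturbation of $T$. A maximum
principle with irreducibility and aperiodicity leaves only constants as eigensequences with
$|\lambda|\ge1$ (`IsWalk.peripheral`), and $\pi$-mean zero removes them; Gelfand's formula concludes
(`IsWalk.mem_rateSet`). Lower bound: test on $\gamma^n$ far from the boundary and on eigensequences.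
The measure $\pi$ comes from Cesàro means and the drift inequality; its uniqueness follows from the
convergence itself. -/

lemma phi_one : phi g d a 1 = ∑ k ∈ Finset.Icc (-(g : ℤ)) d, a k := by
  simp [phi]

lemma continuousOn_phi : ContinuousOn (phi g d a) (Set.Ioi 0) := by
  unfold phi
  refine continuousOn_finsetSum _ fun k _ => continuousOn_const.mul ?_
  exact fun t ht => (continuousAt_zpow₀ t k (Or.inl (ne_of_gt ht))).continuousWithinAt

lemma hasDerivAt_phi_one :
    HasDerivAt (phi g d a) (∑ k ∈ Finset.Icc (-(g : ℤ)) d, (k : ℝ) * a k) 1 := by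
  unfold phi
  refine HasDerivAt.fun_sum fun k _ => ?_
  simpa [mul_comm] using (hasDerivAt_zpow k (1 : ℝ) (Or.inl one_ne_zero)).const_mul (a k)

/-- Every term is convex because $a_k\ge0$, and the term $a_{-g}t^{-g}$ alone is already strictly
convex. -/
lemma strictConvexOn_phi (hg : 1 ≤ g) (ha : ∀ k ∈ Finset.Icc (-(g : ℤ)) d, 0 ≤ a k)
    (hl : 0 < a (-(g : ℤ))) : StrictConvexOn ℝ (Set.Ioi 0) (phi g d a) := by
  have hmem : (-(g : ℤ)) ∈ Finset.Icc (-(g : ℤ)) d := by simp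
  have hsplit : phi g d a = fun t => a (-(g : ℤ)) * t ^ (-(g : ℤ)) +
      ∑ k ∈ (Finset.Icc (-(g : ℤ)) d).erase (-(g : ℤ)), a k * t ^ k := by
    ext t
    exact (Finset.add_sum_erase _ _ hmem).symm
  rw [hsplit]
  refine StrictConvexOn.add_convexOn ?_ ?_
  · have h := strictConvexOn_zpow (m := -(g : ℤ)) (by omega) (by omega)
    refine ⟨h.1, fun x hx y hy hxy p q hp hq hpq => ?_⟩
    have := mul_lt_mul_of_pos_left (h.2 hx hy hxy hp hq hpq) hl
    simp only [smul_eq_mul] at this ⊢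
    linarith
  · have : ∀ s : Finset ℤ, s ⊆ Finset.Icc (-(g : ℤ)) d →
        ConvexOn ℝ (Set.Ioi 0) fun t : ℝ => ∑ k ∈ s, a k * t ^ k := by
      intro s
      induction s using Finset.induction_on with
      | empty => intro _; simpa using convexOn_const (0 : ℝ) (convex_Ioi (0 : ℝ))
      | insert k s hk ih =>
        intro hs
        simp only [Finset.sum_insert hk]
        refine ConvexOn.add ?_ (ih fun x hx => hs (Finset.mem_insert_of_mem hx))
        simpa using (convexOn_zpow (𝕜 := ℝ) k).smul (ha k (hs (Finset.mem_insert_self k s)))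
    exact this _ (Finset.erase_subset _ _)

lemma phi_pos (ha : ∀ k ∈ Finset.Icc (-(g : ℤ)) d, 0 ≤ a k)
    (hl : 0 < a (-(g : ℤ))) {t : ℝ} (ht : 0 < t) : 0 < phi g d a t := by
  have hmem : (-(g : ℤ)) ∈ Finset.Icc (-(g : ℤ)) d := by simp
  refine Finset.sum_pos' (fun k hk => mul_nonneg (ha k hk) (by positivity)) ⟨_, hmem, ?_⟩
  positivity

/-- The derivative of $\varphi$ at $1$ is the drift, so $\varphi$ dips below $\varphi(1)=1$ just to
the right of $1$. Beyond $1/a_d$ the term $a_dt^d$ is at least $1$, which reduces the problem to a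
compact interval, and the minimum there cannot sit at $1$. -/
lemma exists_isMinimizer (hd : 1 ≤ d) (ha : ∀ k ∈ Finset.Icc (-(g : ℤ)) d, 0 ≤ a k)
    (hr : 0 < a d) (hsum : ∑ k ∈ Finset.Icc (-(g : ℤ)) d, a k = 1)
    (hneri : ∑ k ∈ Finset.Icc (-(g : ℤ)) d, (k : ℝ) * a k < 0) :
    ∃ γ, IsMinimizer g d a γ ∧ phi g d a γ < 1 := by
  obtain ⟨t₀, ht₀, hφt₀⟩ : ∃ t₀ : ℝ, 1 < t₀ ∧ phi g d a t₀ < 1 := by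
    have h := (hasDerivAt_iff_tendsto_slope.1 (hasDerivAt_phi_one (g := g) (d := d) (a := a)))
    have h1 := h.eventually (gt_mem_nhds hneri)
    have h2 : nhdsWithin (1 : ℝ) (Set.Ioi 1) ≤ nhdsWithin 1 {1}ᶜ :=
      nhdsWithin_mono _ fun x hx => ne_of_gt hx
    obtain ⟨t, ht, ht1⟩ := (Filter.Eventually.and (h2 h1) self_mem_nhdsWithin).exists
    refine ⟨t, ht1, ?_⟩
    have ht1' : 0 < t - 1 := sub_pos.2 ht1
    rw [slope_def_field, phi_one, hsum, div_neg_iff] at ht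
    rcases ht with h | h
    · linarith
    · linarith
  set B : ℝ := max t₀ (1 / a d)
  have hB : ∀ t : ℝ, B < t → 1 ≤ phi g d a t := by
    intro t ht
    have h1 : 1 < t := lt_of_lt_of_le ht₀ ((le_max_left _ _).trans ht.le)
    have h2 : 1 ≤ a d * t := by
      have := (le_max_right t₀ (1 / a d)).trans ht.le
      rwa [div_le_iff₀' hr] at this
    have hmem : (d : ℤ) ∈ Finset.Icc (-(g : ℤ)) d := by simp
    have h3 : a d * t ^ (d : ℤ) ≤ phi g d a t :=
      Finset.single_le_sum (f := fun k => a k * t ^ k)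
        (fun k hk => mul_nonneg (ha k hk) (by positivity)) hmem
    have h4 : t ≤ t ^ d := le_self_pow₀ h1.le (by omega)
    rw [zpow_natCast] at h3
    nlinarith
  obtain ⟨γ, hγ, hmin⟩ := isCompact_Icc.exists_isMinOn (s := Set.Icc 1 B)
    ⟨t₀, ht₀.le, le_max_left _ _⟩
    ((continuousOn_phi (g := g) (d := d) (a := a)).mono fun x hx => lt_of_lt_of_le one_pos hx.1)
  have hlt : phi g d a γ < 1 := lt_of_le_of_lt (hmin ⟨ht₀.le, le_max_left _ _⟩) hφt₀
  have hγ1 : 1 < γ := by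
    refine lt_of_le_of_ne hγ.1 fun h => ?_
    rw [← h, phi_one, hsum] at hlt
    exact lt_irrefl _ hlt
  refine ⟨γ, ⟨hγ1, fun t ht => ?_⟩, hlt⟩
  rcases le_or_gt t B with h | h
  · exact hmin ⟨le_of_lt ht, h⟩
  · exact hlt.le.trans (hB t h)

lemma IsMinimizer.eq (hg : 1 ≤ g) (ha : ∀ k ∈ Finset.Icc (-(g : ℤ)) d, 0 ≤ a k)
    (hl : 0 < a (-(g : ℤ))) {γ γ' : ℝ} (h : IsMinimizer g d a γ) (h' : IsMinimizer g d a γ') :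
    γ' = γ :=
  ((strictConvexOn_phi hg ha hl).subset (Set.Ioi_subset_Ioi zero_le_one)
    (convex_Ioi 1)).eq_of_isMinOn h'.2 h.2 h'.1 h.1

end Minimizer

/-! ### Evaluation of the elimination polynomials at actual roots -/

section Elimination

variable {g d c : ℕ} {a : ℤ → ℝ}

lemma charPoly_map {A B : Type*} [CommRing A] [Algebra ℝ A] [CommRing B] [Algebra ℝ B]
    (F : A →ₐ[ℝ] B) (lam : A) :
    (charPoly g d a lam).map (F : A →+* B) = charPoly g d a (F lam) := by
  simp [charPoly, Polynomial.map_sum]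

lemma map_zseq {A B : Type*} [CommRing A] [CommRing B] (F : A →+* B) (z : A) (k n : ℕ) :
    F (zseq z k n) = zseq (F z) k n := by
  simp [zseq]

lemma map_boundaryCoeff {P : ℕ → ℕ → ℝ} {A B : Type*} [CommRing A] [Algebra ℝ A] [CommRing B]
    [Algebra ℝ B] (F : A →ₐ[ℝ] B) (lam z : A) (k b : ℕ) :
    F (boundaryCoeff P c lam z k b) = boundaryCoeff P c (F lam) (F z) k b := by
  have h : ∀ z k n, F (zseq z k n) = zseq (F z) k n := fun z k n => map_zseq (F : A →+* B) z k n
  simp [boundaryCoeff, h]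

/-- Evaluation of the indeterminates `λ, z_1, …, z_s` at complex numbers. -/
def evalAt {s : ℕ} (lam : ℂ) (z : Fin s → ℂ) : MvPolynomial (Fin s) ℂ[X] →+* ℂ :=
  MvPolynomial.eval₂Hom (Polynomial.evalRingHom lam) z

/-- `evalAt` as a homomorphism of real algebras. -/
def evalAtAlg {s : ℕ} (lam : ℂ) (z : Fin s → ℂ) : MvPolynomial (Fin s) ℂ[X] →ₐ[ℝ] ℂ :=
  { evalAt lam z with
    commutes' := fun r => by
      rw [IsScalarTower.algebraMap_apply ℝ ℂ[X] (MvPolynomial (Fin s) ℂ[X])]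
      simp [evalAt, MvPolynomial.algebraMap_eq, Polynomial.algebraMap_apply] }

lemma evalAtAlg_apply {s : ℕ} (lam : ℂ) (z : Fin s → ℂ) (p : MvPolynomial (Fin s) ℂ[X]) :
    evalAtAlg lam z p = evalAt lam z p := rfl

lemma coe_evalAtAlg {s : ℕ} (lam : ℂ) (z : Fin s → ℂ) :
    ((evalAtAlg lam z : MvPolynomial (Fin s) ℂ[X] →ₐ[ℝ] ℂ) :
      MvPolynomial (Fin s) ℂ[X] →+* ℂ) = evalAt lam z := rfl

@[simp] lemma evalAt_C {s : ℕ} (lam : ℂ) (z : Fin s → ℂ) (p : ℂ[X]) :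
    evalAt lam z (MvPolynomial.C p) = p.eval lam := by simp [evalAt]

@[simp] lemma evalAt_X {s : ℕ} (lam : ℂ) (z : Fin s → ℂ) (i : Fin s) :
    evalAt lam z (MvPolynomial.X i) = z i := by simp [evalAt]

/-- The leading coefficient $a_d$ does not involve $\lambda$. Positivity of the degree is needed for
the resultants, and constancy of the leading coefficient makes the roots integral over $\mathbb
C[\lambda]$. -/
lemma natDegree_charPoly {A : Type*} [CommRing A] [Algebra ℝ A] [Nontrivial A]
    (hd : 1 ≤ d) (hr : a d ≠ 0) (lam : A) :
    (charPoly g d a lam).natDegree = g + d ∧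
      (charPoly g d a lam).coeff (g + d) = algebraMap ℝ A (a d) := by
  have hc : (charPoly g d a lam).coeff (g + d) = algebraMap ℝ A (a d) := by
    have hmem : (d : ℤ) ∈ Finset.Icc (-(g : ℤ)) d := by simp
    rw [charPoly, coeff_sub, coeff_C_mul_X_pow, if_neg (by omega), sub_zero, finsetSum_coeff,
      Finset.sum_eq_single_of_mem _ hmem]
    · rw [coeff_C_mul_X_pow, if_pos (by omega)]
    · intro k hk hkd
      rw [Finset.mem_Icc] at hk
      rw [coeff_C_mul_X_pow, if_neg (by omega)]
  refine ⟨natDegree_eq_of_le_of_coeff_ne_zero ?_ ?_, hc⟩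
  · refine (natDegree_sub_le_of_le (natDegree_sum_le_of_forall_le _ _ fun k hk => ?_)
      (natDegree_C_mul_X_pow_le _ _)).trans (max_le le_rfl (by omega))
    rw [Finset.mem_Icc] at hk
    exact (natDegree_C_mul_X_pow_le _ _).trans (by omega)
  · rw [hc]
    exact fun h => hr ((algebraMap ℝ A).injective (h.trans (map_zero _).symm))

/-- If `p` vanishes at `(λ, z_1, …, z_s)` and all `z_i` are roots of `E_λ`, then `λ` is a root of
the polynomial obtained by eliminating `z_s, …, z_1`. -/
lemma eval_eliminate_eq_zero (hd : 1 ≤ d) (hr : a d ≠ 0) (lam : ℂ) :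
    ∀ (s : ℕ) (z : Fin s → ℂ) (p : MvPolynomial (Fin s) ℂ[X]),
      (∀ i, (charPoly g d a lam).eval (z i) = 0) → evalAt lam z p = 0 →
      (eliminate g d a s p).eval lam = 0
  | 0, z, p, _, hp => by
    rw [eliminate]
    obtain ⟨q, rfl⟩ := MvPolynomial.C_surjective (R := ℂ[X]) (Fin 0) p
    rw [evalAt_C] at hp
    rwa [← MvPolynomial.algebraMap_eq, AlgEquiv.commutes]
  | s + 1, z, p, hz, hp => by
    rw [eliminate]
    refine eval_eliminate_eq_zero hd hr lam s (fun i => z i.castSucc) _ (fun i => hz _) ?_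
    set f := MvPolynomial.optionEquivLeft ℂ[X] (Fin s) (MvPolynomial.rename finSuccEquivLast p)
    set q := charPoly g d a (MvPolynomial.C X : MvPolynomial (Fin s) ℂ[X])
    -- The resultant lies in the ideal generated by `f` and `q`, so it vanishes wherever both do.
    -- Only `q` needs positive degree; `f` may be constant.
    obtain ⟨u, v, -, -, huv⟩ := exists_mul_add_mul_eq_C_resultant f q
      (m := f.natDegree) (n := q.natDegree) le_rfl le_rfl
      (Or.inr (by rw [(natDegree_charPoly hd hr _).1]; omega))
    have key := congrArg (fun w => (w.map (evalAt lam fun i => z i.castSucc)).eval (z (Fin.last s)))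
      huv
    have hq : (q.map (evalAt lam fun i => z i.castSucc)).eval (z (Fin.last s)) = 0 := by
      rw [← coe_evalAtAlg, charPoly_map, evalAtAlg_apply, evalAt_C, eval_X]
      exact hz _
    have hf : (f.map (evalAt lam fun i => z i.castSucc)).eval (z (Fin.last s)) =
        evalAt lam z p := by
      have : ((Polynomial.evalRingHom (z (Fin.last s))).comp
          ((Polynomial.mapRingHom (evalAt lam fun i => z i.castSucc)).comp
          ((MvPolynomial.optionEquivLeft ℂ[X] (Fin s)).toRingEquiv.toRingHom.comp
          (MvPolynomial.rename (R := ℂ[X]) (finSuccEquivLast (n := s))).toRingHom))) =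
          evalAt lam z := by
        refine MvPolynomial.ringHom_ext (fun r => ?_) (fun i => ?_)
        · simp [MvPolynomial.optionEquivLeft_C]
        · refine Fin.lastCases ?_ (fun i => ?_) i
          · simp
          · simp
      exact congrArg (fun F => F p) this
    simp only [Polynomial.map_add, Polynomial.map_mul, eval_add, eval_mul, hq, hf, hp, zero_mul,
      add_zero, Polynomial.map_C, eval_C] at key
    exact key.symm

/-- Both branches of the quotient are covered: a true quotient vanishes because the divisor has
nonzero value, and the default value is `p` itself. Exactness of the division is therefore not
needed here. -/
lemma evalAt_exactQuot {s : ℕ} (lam : ℂ) (z : Fin s → ℂ) {p q : MvPolynomial (Fin s) ℂ[X]}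
    (hp : evalAt lam z p = 0) (hq : evalAt lam z q ≠ 0) : evalAt lam z (exactQuot p q) = 0 := by
  unfold exactQuot
  split_ifs with h
  · have := congrArg (evalAt lam z) h.choose_spec
    rw [hp, map_mul] at this
    exact (mul_eq_zero.1 this.symm).resolve_left hq
  · exact hp

lemma evalAt_diffProd_ne_zero {s : ℕ} (lam : ℂ) (z : Fin s → ℂ) (hz : Function.Injective z)
    (m : Fin s → ℕ) : evalAt lam z (diffProd m) ≠ 0 := by
  simp only [diffProd, map_prod, map_pow, map_sub, evalAt_X]
  refine Finset.prod_ne_zero_iff.2 fun i _ => Finset.prod_ne_zero_iff.2 fun j hj => ?_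
  exact pow_ne_zero _ (sub_ne_zero.2 fun h => (Finset.mem_Ioi.1 hj).ne (hz h))

/-- A nonzero solution of the full boundary system is a kernel vector of each square subsystem. -/
lemma evalAt_minor_eq_zero {P : ℕ → ℕ → ℝ} {s : ℕ} (lam : ℂ) (z : Fin s → ℂ) (m : Fin s → ℕ)
    (r : Fin (∑ i, m i) ↪o Fin g) (α : (Σ i : Fin s, Fin (m i)) → ℂ) (hα : α ≠ 0)
    (h : ∀ b < g, ∑ q, boundaryCoeff P c lam (z q.1) (q.2 + 1) b * α q = 0) :
    evalAt lam z (minor P c g m r) = 0 := by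
  rw [minor, RingHom.map_det]
  refine Matrix.exists_mulVec_eq_zero_iff.1 ⟨α, hα, ?_⟩
  ext p
  rw [Matrix.mulVec, dotProduct, Pi.zero_apply, ← h _ (r (finSigmaFinEquiv p)).2]
  refine Finset.sum_congr rfl fun q _ => ?_
  rw [RingHom.mapMatrix_apply, Matrix.map_apply, Matrix.of_apply, ← evalAtAlg_apply,
    map_boundaryCoeff]
  simp [evalAtAlg_apply]

end Elimination

/-! ### Sequences of exponential growth and the shift -/

section Shift

/-- The shift `f ↦ f(· + 1)` on complex sequences. -/
def shift : (ℕ → ℂ) →ₗ[ℂ] (ℕ → ℂ) := LinearMap.funLeft ℂ ℂ (· + 1)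

lemma shift_apply (f : ℕ → ℂ) (n : ℕ) : shift f n = f (n + 1) := rfl

lemma shift_pow_apply (k : ℕ) (f : ℕ → ℂ) (n : ℕ) : (shift ^ k) f n = f (n + k) := by
  induction k generalizing n with
  | zero => simp
  | succ k ih => rw [pow_succ', Module.End.mul_apply, shift_apply, ih]; ring_nf

lemma aeval_shift_apply (p : ℂ[X]) (f : ℕ → ℂ) (n : ℕ) :
    aeval shift p f n = ∑ i ∈ Finset.range (p.natDegree + 1), p.coeff i * f (n + i) := by
  rw [aeval_eq_sum_range, LinearMap.sum_apply, Finset.sum_apply]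
  simp [shift_pow_apply]

/-- Recurrences are read as polynomials in the shift, so that factoring $E_\lambda$ factors the
recurrence. -/
lemma aeval_shift_mul (p q : ℂ[X]) (f : ℕ → ℂ) :
    aeval shift (p * q) f = aeval shift p (aeval shift q f) := by
  rw [map_mul, Module.End.mul_apply]

lemma aeval_shift_X_sub_C (z : ℂ) (f : ℕ → ℂ) (n : ℕ) :
    aeval shift (X - C z) f n = f (n + 1) - z * f n := by
  simp [shift_apply, Module.algebraMap_end_apply]

/-- The sequences `f` with `f(n) = O(γ^n)`. -/
def growth (γ : ℝ) : Submodule ℂ (ℕ → ℂ) where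
  carrier := {f | ∃ C : ℝ, ∀ n, ‖f n‖ ≤ C * γ ^ n}
  zero_mem' := ⟨0, fun n => by simp⟩
  add_mem' := by
    rintro f h ⟨C, hC⟩ ⟨D, hD⟩
    refine ⟨C + D, fun n => (norm_add_le _ _).trans ?_⟩
    rw [add_mul]
    exact add_le_add (hC n) (hD n)
  smul_mem' := by
    rintro x f ⟨C, hC⟩
    refine ⟨‖x‖ * C, fun n => ?_⟩
    rw [Pi.smul_apply, norm_smul, mul_assoc]
    exact mul_le_mul_of_nonneg_left (hC n) (norm_nonneg _)

variable {γ : ℝ}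

lemma shift_mem_growth {f : ℕ → ℂ} (hf : f ∈ growth γ) : shift f ∈ growth γ := by
  obtain ⟨C, hC⟩ := hf
  refine ⟨C * γ, fun n => ?_⟩
  rw [shift_apply, mul_assoc, ← pow_succ']
  exact hC _

lemma aeval_shift_mem_growth (p : ℂ[X]) {f : ℕ → ℂ} (hf : f ∈ growth γ) :
    aeval shift p f ∈ growth γ := by
  have hk : ∀ k, (shift ^ k) f ∈ growth γ := fun k => by
    induction k with
    | zero => simpa
    | succ k ih => rw [pow_succ', Module.End.mul_apply]; exact shift_mem_growth ih
  rw [aeval_eq_sum_range, LinearMap.sum_apply]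
  exact Submodule.sum_mem _ fun k _ => Submodule.smul_mem _ _ (hk k)

/-- A geometric sequence of ratio $z$ with $|z|>\gamma$ is $O(\gamma^n)$ only if it vanishes. -/
lemma eq_zero_of_shift_eq_of_lt_norm (hγ : 0 < γ) {f : ℕ → ℂ} (hf : f ∈ growth γ) {z : ℂ}
    (hz : γ < ‖z‖) (h : aeval shift (X - C z) f = 0) : f = 0 := by
  have hn : ∀ n, f n = z ^ n * f 0 := fun n => by
    induction n with
    | zero => simp
    | succ n ih =>
      have := congrFun h n
      rw [aeval_shift_X_sub_C, Pi.zero_apply, sub_eq_zero] at this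
      rw [this, ih]; ring
  obtain ⟨C, hC⟩ := hf
  have h0 : f 0 = 0 := by
    by_contra h0
    have hpos : 0 < ‖f 0‖ := norm_pos_iff.2 h0
    have ht := tendsto_pow_atTop_atTop_of_one_lt ((one_lt_div hγ).2 hz)
    obtain ⟨n, hn'⟩ := (ht.eventually_gt_atTop (C / ‖f 0‖)).exists
    have h1 := hC n
    rw [hn, norm_mul, norm_pow] at h1
    rw [div_pow, div_lt_div_iff₀ hpos (by positivity)] at hn'
    linarith
  ext n
  rw [hn, h0, mul_zero, Pi.zero_apply]

lemma eq_zero_of_aeval_prod_eq_zero (hγ : 0 < γ) (s : Multiset ℂ) (hs : ∀ z ∈ s, γ < ‖z‖)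
    {f : ℕ → ℂ} (hf : f ∈ growth γ) (h : aeval shift (s.map fun z => X - C z).prod f = 0) :
    f = 0 := by
  induction s using Multiset.induction_on with
  | empty => simpa using h
  | cons z s ih =>
    rw [Multiset.map_cons, Multiset.prod_cons, aeval_shift_mul] at h
    exact ih (fun w hw => hs w (Multiset.mem_cons_of_mem hw))
      (eq_zero_of_shift_eq_of_lt_norm hγ (aeval_shift_mem_growth _ hf)
        (hs z (Multiset.mem_cons_self _ _)) h)

/-- A solution of a monic linear recurrence is determined by its initial values. -/
lemma eq_zero_of_monic_recurrence {q : ℂ[X]} (hq : q.Monic) {f : ℕ → ℂ}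
    (h : aeval shift q f = 0) (h0 : ∀ n < q.natDegree, f n = 0) : f = 0 := by
  ext n
  induction n using Nat.strong_induction_on with
  | _ n ih =>
    rcases lt_or_ge n q.natDegree with hn | hn
    · exact h0 n hn
    · have := congrFun h (n - q.natDegree)
      rw [aeval_shift_apply, Finset.sum_range_succ, hq.coeff_natDegree, Finset.sum_eq_zero,
        zero_add, one_mul, Nat.sub_add_cancel hn] at this
      · exact this
      · intro i hi
        rw [Finset.mem_range] at hi
        rw [ih _ (by omega), Pi.zero_apply, mul_zero]

/-- The $z^{(k)}$ form a Jordan chain of the shift at $z$. For $k=0$ truncated subtraction makes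
$z^{(0)}=z^{(1)}$, which is harmless because the factor $k$ vanishes. -/
lemma shift_sub_zseq (z : ℂ) (k : ℕ) :
    aeval shift (X - C z) (zseq z (k + 1)) = (k : ℂ) • zseq z k := by
  ext n
  rw [aeval_shift_X_sub_C, Pi.smul_apply, smul_eq_mul]
  simp only [zseq, Nat.add_sub_cancel]
  cases k with
  | zero => simp [pow_succ']
  | succ k =>
    rw [Nat.succ_descFactorial_succ, Nat.descFactorial_succ]
    rcases lt_or_ge k n with hn | hn
    · obtain ⟨m, rfl⟩ : ∃ m, n = m + k + 1 := ⟨n - (k + 1), by omega⟩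
      have e1 : m + k + 1 + 1 - (k + 1) = m + 1 := by omega
      have e2 : m + k + 1 - (k + 1) = m := by omega
      have e3 : m + k + 1 - k = m + 1 := by omega
      simp only [e1, e2, Nat.add_sub_cancel, e3]
      push_cast
      ring
    · rcases hn.eq_or_lt with rfl | hn
      · simp
      · simp [Nat.descFactorial_of_lt hn]

lemma aeval_X_sub_C_pow_zseq (z : ℂ) (m : ℕ) {k : ℕ} (hk : 1 ≤ k) (hkm : k ≤ m) :
    aeval shift ((X - C z) ^ m) (zseq z k) = 0 := by
  induction m generalizing k with
  | zero => omega
  | succ m ih =>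
    obtain ⟨j, rfl⟩ : ∃ j, k = j + 1 := ⟨k - 1, by omega⟩
    rw [pow_succ, aeval_shift_mul, shift_sub_zseq, map_smul]
    rcases Nat.eq_zero_or_pos j with rfl | hj
    · simp
    · rw [ih hj (by omega), smul_zero]

/-- A polynomial factor does not compensate $(|z|/\gamma)^n$. The case $z=0$ is excluded so that
$|z|^{n-k+1}$ is a constant times $|z|^n$; roots of $E_\lambda$ are nonzero because
$E_\lambda(0)=a_{-g}$. -/
lemma tendsto_zseq (hγ : 0 < γ) {z : ℂ} (hz0 : z ≠ 0) (hz : ‖z‖ < γ) (k : ℕ) :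
    Filter.Tendsto (fun n => ‖zseq z k n‖ / γ ^ n) Filter.atTop (nhds 0) := by
  have hpos : 0 < ‖z‖ := norm_pos_iff.2 hz0
  have h := (tendsto_pow_const_mul_const_pow_of_abs_lt_one (k - 1) (r := ‖z‖ / γ)
    (by rw [abs_of_pos (by positivity)]; exact (div_lt_one hγ).2 hz)).const_mul
    ((‖z‖ ^ (k - 1))⁻¹)
  rw [mul_zero] at h
  refine squeeze_zero (fun n => by positivity) (fun n => ?_) h
  rcases lt_or_ge n (k - 1) with hn | hn
  · simp only [zseq, Nat.descFactorial_of_lt hn]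
    simp only [Nat.cast_zero, zero_mul, norm_zero, zero_div]
    positivity
  · have h1 : (n.descFactorial (k - 1) : ℝ) ≤ (n : ℝ) ^ (k - 1) := by
      exact_mod_cast Nat.descFactorial_le_pow n (k - 1)
    have h2 : ‖z‖ ^ (n - (k - 1)) = (‖z‖ ^ (k - 1))⁻¹ * ‖z‖ ^ n := by
      rw [pow_sub₀ _ hpos.ne' hn, mul_comm]
    rw [zseq, norm_mul, norm_pow, h2, Complex.norm_natCast, div_pow]
    rw [div_le_iff₀ (by positivity)]
    have : (‖z‖ ^ (k - 1))⁻¹ * ((n : ℝ) ^ (k - 1) * (‖z‖ ^ n / γ ^ n)) * γ ^ n =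
      (n : ℝ) ^ (k - 1) * ((‖z‖ ^ (k - 1))⁻¹ * ‖z‖ ^ n) := by
      field_simp
    rw [this]
    gcongr

lemma mem_growth_of_tendsto (hγ : 0 < γ) {f : ℕ → ℂ}
    (h : Filter.Tendsto (fun n => ‖f n‖ / γ ^ n) Filter.atTop (nhds 0)) : f ∈ growth γ := by
  obtain ⟨C, hC⟩ := h.bddAbove_range
  refine ⟨C, fun n => ?_⟩
  rw [← div_le_iff₀ (by positivity)]
  exact hC ⟨n, rfl⟩

/-- The sequences `z^{(k)}` are linearly independent. -/
lemma zseq_independent (R : Finset ℂ) (m : ℂ → ℕ) (α : ℂ → ℕ → ℂ)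
    (h : ∀ n, ∑ z ∈ R, ∑ k ∈ Finset.Icc 1 (m z), α z k * zseq z k n = 0) :
    ∀ z ∈ R, ∀ k ∈ Finset.Icc 1 (m z), α z k = 0 := by
  set F : ℂ → ℕ → ℂ := fun z n => ∑ k ∈ Finset.Icc 1 (m z), α z k * zseq z k n
  have hF : ∀ z, F z = ∑ k ∈ Finset.Icc 1 (m z), α z k • zseq z k := fun z => by
    ext n; simp [F]
  -- Independence across different $z$ is independence of the generalized eigenspaces of the shift.
  have hmem : ∀ z, F z ∈ Module.End.maxGenEigenspace shift z := by
    intro z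
    rw [Module.End.mem_maxGenEigenspace]
    refine ⟨m z, ?_⟩
    have he : (shift - z • (1 : Module.End ℂ (ℕ → ℂ))) ^ m z = aeval shift ((X - C z) ^ m z) := by
      rw [map_pow, map_sub, aeval_X, aeval_C, Algebra.algebraMap_eq_smul_one]
    rw [he, hF, map_sum]
    refine Finset.sum_eq_zero fun k hk => ?_
    rw [Finset.mem_Icc] at hk
    rw [map_smul, aeval_X_sub_C_pow_zseq z _ hk.1 hk.2, smul_zero]
  have hzero : ∀ z ∈ R, F z = 0 := by
    exact (iSupIndep_iff_finsetSum_eq_zero_imp_eq_zero _).1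
      (Module.End.independent_maxGenEigenspace (R := ℂ) shift) R F (fun z _ => hmem z)
      (by ext n; simpa [F] using h n)
  intro z hz k hk
  -- For a single $z$ the system is triangular: at $n=k-1$ all $z^{(j)}$ with $j>k$ vanish, while
  -- $z^{(k)}(k-1)=(k-1)!$.
  induction k using Nat.strong_induction_on with
  | _ k ih =>
    have h1 : F z (k - 1) = 0 := by rw [hzero z hz]; rfl
    simp only [F] at h1
    rw [Finset.sum_eq_single_of_mem k hk] at h1
    · have h2 : zseq z k (k - 1) ≠ 0 := by
        simp [zseq, Nat.descFactorial_self, Nat.factorial_ne_zero]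
      exact (mul_eq_zero.1 h1).resolve_right h2
    · intro j hj hjk
      rcases lt_or_gt_of_ne hjk with hlt | hgt
      · rw [ih j hlt hj, zero_mul]
      · rw [Finset.mem_Icc] at hk hj
        rw [zseq, Nat.descFactorial_of_lt (by omega), Nat.cast_zero, zero_mul, mul_zero]

end Shift

/-! ### Kernel operators on weighted sequences -/

section KernelOperators

open BoundedContinuousFunction

/-- `K` is a nonnegative kernel with `∑_j K(i,j) γ^j ≤ B γ^i`. -/
structure WeightBounded (γ : ℝ) (K : ℕ → ℕ → ℝ) (B : ℝ) : Prop where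
  nonneg : ∀ i j, 0 ≤ K i j
  summable : ∀ i, Summable fun j => K i j * γ ^ j
  tsum_le : ∀ i, ∑' j, K i j * γ ^ j ≤ B * γ ^ i

variable {γ : ℝ}

/-- The sequence `n ↦ γ^n h(n)` attached to a bounded sequence `h`. -/
def toSeq (γ : ℝ) : (ℕ →ᵇ ℂ) →ₗ[ℂ] (ℕ → ℂ) where
  toFun h n := (γ : ℂ) ^ n * h n
  map_add' h₁ h₂ := by ext n; simp [mul_add]
  map_smul' x h := by ext n; simp [mul_left_comm]

lemma toSeq_apply (h : ℕ →ᵇ ℂ) (n : ℕ) : toSeq γ h n = (γ : ℂ) ^ n * h n := rfl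

lemma norm_toSeq (hγ : 0 < γ) (h : ℕ →ᵇ ℂ) (n : ℕ) : ‖toSeq γ h n‖ = γ ^ n * ‖h n‖ := by
  rw [toSeq_apply, norm_mul, norm_pow, Complex.norm_real, Real.norm_of_nonneg hγ.le]

lemma norm_toSeq_le (hγ : 0 < γ) (h : ℕ →ᵇ ℂ) (n : ℕ) : ‖toSeq γ h n‖ ≤ ‖h‖ * γ ^ n := by
  rw [norm_toSeq hγ, mul_comm]
  exact mul_le_mul_of_nonneg_right (h.norm_coe_le_norm n) (by positivity)

lemma toSeq_mem_growth (hγ : 0 < γ) (h : ℕ →ᵇ ℂ) : toSeq γ h ∈ growth γ :=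
  ⟨‖h‖, norm_toSeq_le hγ h⟩

lemma toSeq_injective (hγ : 0 < γ) : Function.Injective (toSeq γ) := by
  intro h₁ h₂ h
  ext n
  have := congrFun h n
  rw [toSeq_apply, toSeq_apply] at this
  exact mul_left_cancel₀ (pow_ne_zero _ (Complex.ofReal_ne_zero.2 hγ.ne')) this

lemma exists_toSeq_eq (hγ : 0 < γ) {f : ℕ → ℂ} {C : ℝ} (hC : ∀ n, ‖f n‖ ≤ C * γ ^ n) :
    ∃ h : ℕ →ᵇ ℂ, toSeq γ h = f ∧ ‖h‖ ≤ C := by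
  have hb : ∀ n, ‖f n / (γ : ℂ) ^ n‖ ≤ C := fun n => by
    rw [norm_div, norm_pow, Complex.norm_real, Real.norm_of_nonneg hγ.le,
      div_le_iff₀ (by positivity)]
    exact hC n
  have hC0 : 0 ≤ C := (norm_nonneg _).trans (hb 0)
  refine ⟨ofNormedAddCommGroupDiscrete (fun n => f n / (γ : ℂ) ^ n) C hb, ?_, ?_⟩
  · ext n
    rw [toSeq_apply, coe_ofNormedAddCommGroupDiscrete]
    exact mul_div_cancel₀ _ (pow_ne_zero _ (Complex.ofReal_ne_zero.2 hγ.ne'))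
  · exact (norm_le hC0).2 hb

variable {K : ℕ → ℕ → ℝ} {B : ℝ}

lemma WeightBounded.summable_norm (hK : WeightBounded γ K B) {f : ℕ → ℂ} {C : ℝ}
    (hC : ∀ n, ‖f n‖ ≤ C * γ ^ n) (i : ℕ) : Summable fun j => ‖(K i j : ℂ) * f j‖ := by
  refine Summable.of_nonneg_of_le (fun _ => norm_nonneg _) (fun j => ?_)
    ((hK.summable i).mul_left C)
  rw [norm_mul, Complex.norm_real, Real.norm_of_nonneg (hK.nonneg i j)]
  calc K i j * ‖f j‖ ≤ K i j * (C * γ ^ j) := mul_le_mul_of_nonneg_left (hC j) (hK.nonneg i j)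
    _ = C * (K i j * γ ^ j) := by ring

lemma WeightBounded.summable_act (hK : WeightBounded γ K B) {f : ℕ → ℂ} (hf : f ∈ growth γ)
    (i : ℕ) : Summable fun j => (K i j : ℂ) * f j := by
  obtain ⟨C, hC⟩ := hf
  exact (hK.summable_norm hC i).of_norm

lemma WeightBounded.norm_act_le (hK : WeightBounded γ K B) {f : ℕ → ℂ} {C : ℝ} (hC0 : 0 ≤ C)
    (hC : ∀ n, ‖f n‖ ≤ C * γ ^ n) (i : ℕ) : ‖act K f i‖ ≤ C * B * γ ^ i := by
  calc ‖act K f i‖ ≤ ∑' j, ‖(K i j : ℂ) * f j‖ := norm_tsum_le_tsum_norm (hK.summable_norm hC i)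
    _ ≤ ∑' j, C * (K i j * γ ^ j) := by
        refine (hK.summable_norm hC i).tsum_le_tsum (fun j => ?_) ((hK.summable i).mul_left C)
        rw [norm_mul, Complex.norm_real, Real.norm_of_nonneg (hK.nonneg i j)]
        calc K i j * ‖f j‖ ≤ K i j * (C * γ ^ j) :=
              mul_le_mul_of_nonneg_left (hC j) (hK.nonneg i j)
          _ = C * (K i j * γ ^ j) := by ring
    _ = C * ∑' j, K i j * γ ^ j := tsum_mul_left
    _ ≤ C * (B * γ ^ i) := mul_le_mul_of_nonneg_left (hK.tsum_le i) hC0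
    _ = C * B * γ ^ i := by ring

lemma act_add {f₁ f₂ : ℕ → ℂ} (hK : WeightBounded γ K B) (h₁ : f₁ ∈ growth γ)
    (h₂ : f₂ ∈ growth γ) : act K (f₁ + f₂) = act K f₁ + act K f₂ := by
  ext i
  rw [Pi.add_apply, act, act, act, ← (hK.summable_act h₁ i).tsum_add (hK.summable_act h₂ i)]
  simp [mul_add]

lemma act_smul (x : ℂ) (f : ℕ → ℂ) : act K (x • f) = x • act K f := by
  ext i
  simp only [act, Pi.smul_apply, smul_eq_mul, mul_left_comm _ x]
  exact tsum_mul_left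

/-- Multiplication by $\gamma^n$ transports the weighted space to the Banach space of bounded
sequences; the weighted row sums become a bound for the operator norm. -/
lemma exists_kernelOp (hγ : 0 < γ) (hK : WeightBounded γ K B) (hB : 0 ≤ B) :
    ∃ A : (ℕ →ᵇ ℂ) →L[ℂ] (ℕ →ᵇ ℂ), (∀ h, toSeq γ (A h) = act K (toSeq γ h)) ∧ ‖A‖ ≤ B := by
  have hex : ∀ h : ℕ →ᵇ ℂ, ∃ u : ℕ →ᵇ ℂ, toSeq γ u = act K (toSeq γ h) ∧ ‖u‖ ≤ ‖h‖ * B :=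
    fun h => exists_toSeq_eq hγ (hK.norm_act_le (norm_nonneg h) (norm_toSeq_le hγ h))
  choose u hu hub using hex
  let L : (ℕ →ᵇ ℂ) →ₗ[ℂ] (ℕ →ᵇ ℂ) :=
    { toFun := u
      map_add' := fun h₁ h₂ => toSeq_injective hγ (by
        rw [hu, map_add, map_add, hu, hu,
          act_add hK (toSeq_mem_growth hγ _) (toSeq_mem_growth hγ _)])
      map_smul' := fun x h => toSeq_injective hγ (by
        rw [hu, map_smul, RingHom.id_apply, map_smul, hu, act_smul]) }
  refine ⟨L.mkContinuous B fun h => (hub h).trans_eq (mul_comm _ _), fun h => hu h, ?_⟩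
  exact L.mkContinuous_norm_le hB _

/-- The operator on bounded sequences conjugate, by multiplication with `γ^n`, to the action of
the kernel `K`. -/
def kernelOp (hγ : 0 < γ) (hK : WeightBounded γ K B) (hB : 0 ≤ B) : (ℕ →ᵇ ℂ) →L[ℂ] (ℕ →ᵇ ℂ) :=
  (exists_kernelOp hγ hK hB).choose

lemma toSeq_kernelOp (hγ : 0 < γ) (hK : WeightBounded γ K B) (hB : 0 ≤ B) (h : ℕ →ᵇ ℂ) :
    toSeq γ (kernelOp hγ hK hB h) = act K (toSeq γ h) :=
  (exists_kernelOp hγ hK hB).choose_spec.1 h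

lemma norm_kernelOp_le (hγ : 0 < γ) (hK : WeightBounded γ K B) (hB : 0 ≤ B) :
    ‖kernelOp hγ hK hB‖ ≤ B :=
  (exists_kernelOp hγ hK hB).choose_spec.2

end KernelOperators

/-! ### The kernel of a walk -/

section Walk

variable {P : ℕ → ℕ → ℝ} {c g d : ℕ} {a : ℤ → ℝ} {γ : ℝ}

lemma IsWalk.a_nonneg (hP : IsWalk P c g d a) : ∀ k ∈ Finset.Icc (-(g : ℤ)) d, 0 ≤ a k :=
  fun k hk => (hP.a_mem k hk).1

/-- The entries up to $c$ already exhaust the total mass $1$ of a nonnegative row. -/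
lemma IsWalk.boundary_eq_zero (hP : IsWalk P c g d a) {i j : ℕ} (hi : i < g) (hj : c < j) :
    P i j = 0 := by
  have h1 := hP.boundary i hi
  have h2 := sum_le_hasSum (insert j (Finset.range (c + 1))) (fun k _ => hP.markov.1 i k)
    (hP.markov.2 i)
  rw [Finset.sum_insert (by simp; omega), h1] at h2
  exact le_antisymm (by linarith) (hP.markov.1 i j)

lemma IsWalk.hasSum_boundary (hP : IsWalk P c g d a) {i : ℕ} (hi : i < g) {M : Type*}
    [AddCommMonoid M] [TopologicalSpace M] (G : ℕ → M) (hG : ∀ j, P i j = 0 → G j = 0) :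
    HasSum G (∑ j ∈ Finset.range (c + 1), G j) :=
  hasSum_sum_of_ne_finset_zero fun j hj => hG j (hP.boundary_eq_zero hi (by
    rw [Finset.mem_range] at hj; omega))

/-- For $i\ge g$ and $k\ge-g$ one has $i+k\ge0$, so `toNat` truncates nothing and $k\mapsto i+k$
stays injective. -/
lemma IsWalk.hasSum_interior (hP : IsWalk P c g d a) {i : ℕ} (hi : g ≤ i) {M : Type*}
    [AddCommMonoid M] [TopologicalSpace M] (G : ℕ → M) (hG : ∀ j, P i j = 0 → G j = 0) :
    HasSum G (∑ k ∈ Finset.Icc (-(g : ℤ)) d, G (i + k).toNat) := by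
  have hinj : Set.InjOn (fun k : ℤ => ((i : ℤ) + k).toNat) (Finset.Icc (-(g : ℤ)) d) := by
    intro k hk l hl h
    simp only [Finset.coe_Icc, Set.mem_Icc] at hk hl h
    omega
  rw [← Finset.sum_image (f := G) hinj]
  refine hasSum_sum_of_ne_finset_zero fun j hj => hG j ?_
  rw [hP.interior i j hi, if_neg]
  rintro ⟨h1, h2⟩
  refine hj (Finset.mem_image.2 ⟨(j : ℤ) - i, Finset.mem_Icc.2 ⟨by omega, by omega⟩, by omega⟩)

lemma IsWalk.interior_apply (hP : IsWalk P c g d a) {i : ℕ} (hi : g ≤ i) {k : ℤ}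
    (hk : k ∈ Finset.Icc (-(g : ℤ)) d) : P i (i + k).toNat = a k := by
  rw [Finset.mem_Icc] at hk
  rw [hP.interior _ _ hi, if_pos (by omega)]
  congr 1
  omega

lemma IsWalk.act_interior (hP : IsWalk P c g d a) (f : ℕ → ℂ) {i : ℕ} (hi : g ≤ i) :
    act P f i = ∑ k ∈ Finset.Icc (-(g : ℤ)) d, (a k : ℂ) * f (i + k).toNat := by
  rw [act, (hP.hasSum_interior hi (fun j => (P i j : ℂ) * f j)
    (fun j hj => by rw [hj, Complex.ofReal_zero, zero_mul])).tsum_eq]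
  exact Finset.sum_congr rfl fun k hk => by rw [hP.interior_apply hi hk]

lemma IsWalk.act_boundary (hP : IsWalk P c g d a) (f : ℕ → ℂ) {i : ℕ} (hi : i < g) :
    act P f i = ∑ j ∈ Finset.range (c + 1), (P i j : ℂ) * f j := by
  rw [act, (hP.hasSum_boundary hi (fun j => (P i j : ℂ) * f j)
    (fun j hj => by rw [hj, Complex.ofReal_zero, zero_mul])).tsum_eq]

lemma IsWalk.hasSum_weight_interior (hP : IsWalk P c g d a) (hγ : 0 < γ) {i : ℕ} (hi : g ≤ i) :
    HasSum (fun j => P i j * γ ^ j) (phi g d a γ * γ ^ i) := by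
  have h := hP.hasSum_interior hi (fun j => P i j * γ ^ j) (fun j hj => by rw [hj, zero_mul])
  convert h using 1
  rw [phi, Finset.sum_mul]
  refine Finset.sum_congr rfl fun k hk => ?_
  rw [hP.interior_apply hi hk, mul_assoc, ← zpow_natCast, ← zpow_natCast, ← zpow_add₀ hγ.ne']
  rw [Finset.mem_Icc] at hk
  congr 2
  omega

/-- The kernel of the walk killed outside `{g, g+1, …}`. -/
def interiorKernel (P : ℕ → ℕ → ℝ) (g : ℕ) (i j : ℕ) : ℝ := if g ≤ i then P i j else 0

lemma act_interiorKernel (f : ℕ → ℂ) (i : ℕ) :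
    act (interiorKernel P g) f i = if g ≤ i then act P f i else 0 := by
  unfold act interiorKernel
  split_ifs <;> simp

lemma IsWalk.weightBounded_interior (hP : IsWalk P c g d a) (hγ : 0 < γ) :
    WeightBounded γ (interiorKernel P g) (phi g d a γ) where
  nonneg i j := by
    unfold interiorKernel
    split_ifs
    · exact hP.markov.1 i j
    · exact le_rfl
  summable i := by
    unfold interiorKernel
    split_ifs with h
    · exact (hP.hasSum_weight_interior hγ h).summable
    · simp
  tsum_le i := by
    unfold interiorKernel
    split_ifs with h
    · exact (hP.hasSum_weight_interior hγ h).tsum_eq.le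
    · have := phi_pos hP.a_nonneg hP.a_left hγ
      simp only [zero_mul, tsum_zero]
      positivity

/-- The first part is the drift inequality $PV\le\varphi(\gamma)V+\gamma^c$ for $V(i)=\gamma^i$,
which later gives tightness. The second absorbs the constant using $\gamma^i\ge1$ and makes $P$ a
bounded operator. -/
lemma IsWalk.weightBounded (hP : IsWalk P c g d a) (hγ : 1 < γ) :
    (∀ i, ∑' j, P i j * γ ^ j ≤ phi g d a γ * γ ^ i + γ ^ c) ∧
    WeightBounded γ P (phi g d a γ + γ ^ c) := by
  have hγ0 : 0 < γ := by linarith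
  have hphi := phi_pos hP.a_nonneg hP.a_left hγ0
  have hs : ∀ i, Summable fun j => P i j * γ ^ j := fun i => by
    rcases lt_or_ge i g with h | h
    · exact (hP.hasSum_boundary h (fun j => P i j * γ ^ j) fun j hj => by
        rw [hj, zero_mul]).summable
    · exact (hP.hasSum_weight_interior hγ0 h).summable
  have hle : ∀ i, ∑' j, P i j * γ ^ j ≤ phi g d a γ * γ ^ i + γ ^ c := fun i => by
    rcases lt_or_ge i g with h | h
    · rw [(hP.hasSum_boundary h (fun j => P i j * γ ^ j) fun j hj => by
        rw [hj, zero_mul]).tsum_eq]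
      have h1 : ∑ j ∈ Finset.range (c + 1), P i j * γ ^ j ≤
          ∑ j ∈ Finset.range (c + 1), P i j * γ ^ c := by
        refine Finset.sum_le_sum fun j hj => mul_le_mul_of_nonneg_left ?_ (hP.markov.1 i j)
        exact pow_le_pow_right₀ hγ.le (by rw [Finset.mem_range] at hj; omega)
      rw [← Finset.sum_mul, hP.boundary i h, one_mul] at h1
      have : 0 < phi g d a γ * γ ^ i := by positivity
      linarith
    · rw [(hP.hasSum_weight_interior hγ0 h).tsum_eq]
      have : 0 < γ ^ c := by positivity
      linarith
  refine ⟨hle, hP.markov.1, hs, fun i => (hle i).trans ?_⟩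
  have h1 : 1 ≤ γ ^ i := one_le_pow₀ hγ.le
  have h2 : 0 < γ ^ c := by positivity
  nlinarith

/-! ### Characteristic roots -/

lemma eval_charPoly (lam : ℂ) {z : ℂ} (hz : z ≠ 0) :
    (charPoly g d a lam).eval z =
      z ^ g * (∑ k ∈ Finset.Icc (-(g : ℤ)) d, (a k : ℂ) * z ^ k - lam) := by
  rw [charPoly, eval_sub, eval_finsetSum, mul_sub, Finset.mul_sum]
  congr 1
  · refine Finset.sum_congr rfl fun k hk => ?_
    rw [Finset.mem_Icc] at hk
    rw [eval_C_mul, eval_pow, eval_X, ← zpow_natCast, ← zpow_natCast, mul_left_comm,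
      ← zpow_add₀ hz, Complex.coe_algebraMap]
    congr 2
    omega
  · rw [eval_mul, eval_C, eval_pow, eval_X, mul_comm]

lemma eval_zero_charPoly (hg : 1 ≤ g) (lam : ℂ) :
    (charPoly g d a lam).eval 0 = (a (-(g : ℤ)) : ℂ) := by
  have hmem : -(g : ℤ) ∈ Finset.Icc (-(g : ℤ)) d := by simp
  rw [charPoly, eval_sub, eval_finsetSum, Finset.sum_eq_single_of_mem _ hmem]
  · simp [show g ≠ 0 by omega]
  · intro k hk hkg
    rw [Finset.mem_Icc] at hk
    simp [show (g + k).toNat ≠ 0 by omega]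

lemma IsWalk.charPoly_ne_zero (hP : IsWalk P c g d a) (lam : ℂ) : charPoly g d a lam ≠ 0 :=
  fun h => by
    have := (natDegree_charPoly (g := g) (a := a) hP.d_pos hP.a_right.ne' lam).1
    rw [h, natDegree_zero] at this
    have := hP.d_pos
    omega

lemma IsWalk.ne_zero_of_mem_roots (hP : IsWalk P c g d a) {lam z : ℂ}
    (hz : z ∈ (charPoly g d a lam).roots) : z ≠ 0 := by
  rintro rfl
  have := isRoot_of_mem_roots hz
  rw [IsRoot.def, eval_zero_charPoly hP.g_pos] at this
  exact hP.a_left.ne' (by exact_mod_cast this)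

/-- On $|z|=\gamma$ the triangle inequality gives $|\sum_k a_kz^k|\le\varphi(\gamma)<|\lambda|$. -/
lemma IsWalk.norm_ne_of_mem_roots (hP : IsWalk P c g d a) {lam z : ℂ}
    (hlam : phi g d a γ < ‖lam‖) (hz : z ∈ (charPoly g d a lam).roots) : ‖z‖ ≠ γ := by
  intro h
  have h0 := hP.ne_zero_of_mem_roots hz
  have h1 := isRoot_of_mem_roots hz
  rw [IsRoot.def, eval_charPoly _ h0, mul_eq_zero, or_iff_right (pow_ne_zero _ h0),
    sub_eq_zero] at h1
  refine hlam.not_ge ?_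
  rw [← h1, phi]
  refine (norm_sum_le _ _).trans (Finset.sum_le_sum fun k hk => ?_)
  rw [norm_mul, norm_zpow, h, Complex.norm_real, Real.norm_of_nonneg (hP.a_nonneg k hk)]

/-- The factor $z^g$ in $E_\lambda$ moves the equation at $i=n+g$ to index $n$, so the interior
equations become a recurrence valid from $n=0$. -/
lemma IsWalk.aeval_charPoly_apply (hP : IsWalk P c g d a) (lam : ℂ) (f : ℕ → ℂ) (n : ℕ) :
    aeval shift (charPoly g d a lam) f n = act P f (n + g) - lam * f (n + g) := by
  rw [hP.act_interior f (Nat.le_add_left g n), charPoly]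
  simp only [map_sub, map_sum, map_mul, aeval_C, map_pow, aeval_X, LinearMap.sub_apply,
    LinearMap.sum_apply, Pi.sub_apply, Finset.sum_apply, Module.End.mul_apply,
    Module.algebraMap_end_apply, Pi.smul_apply, shift_pow_apply, smul_eq_mul,
    Complex.coe_algebraMap]
  congr 1
  refine Finset.sum_congr rfl fun k hk => ?_
  rw [Finset.mem_Icc] at hk
  congr 2
  push_cast
  omega

lemma IsWalk.aeval_charPoly_eq_zero_iff (hP : IsWalk P c g d a) (lam : ℂ) (f : ℕ → ℂ) :
    aeval shift (charPoly g d a lam) f = 0 ↔ ∀ i, g ≤ i → act P f i = lam * f i := by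
  constructor
  · intro h i hi
    have := congrFun h (i - g)
    rwa [hP.aeval_charPoly_apply, Nat.sub_add_cancel hi, Pi.zero_apply, sub_eq_zero] at this
  · intro h
    ext n
    rw [hP.aeval_charPoly_apply, h _ (Nat.le_add_left g n), sub_self, Pi.zero_apply]

end Walk

/-! ### Solutions of the interior eigenvalue equations -/

section Solutions

open scoped BoundedContinuousFunction

variable {P : ℕ → ℕ → ℝ} {c g d : ℕ} {a : ℤ → ℝ} {γ : ℝ}

/-- The sequences `f = O(γ^n)` with `(P f)(i) = λ f(i)` for all `i ≥ g`, expressed by the shift. -/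
def interiorSolutions (g d : ℕ) (a : ℤ → ℝ) (γ : ℝ) (lam : ℂ) : Submodule ℂ (ℕ → ℂ) :=
  growth γ ⊓ LinearMap.ker (aeval shift (charPoly g d a lam))

lemma IsWalk.mem_interiorSolutions (hP : IsWalk P c g d a) {lam : ℂ} {f : ℕ → ℂ} :
    f ∈ interiorSolutions g d a γ lam ↔
      f ∈ growth γ ∧ ∀ i, g ≤ i → act P f i = lam * f i := by
  rw [interiorSolutions, Submodule.mem_inf, LinearMap.mem_ker, hP.aeval_charPoly_eq_zero_iff]

/-- The operator of the interior kernel on bounded sequences. -/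
def IsWalk.interiorOp (hP : IsWalk P c g d a) (hγ : 0 < γ) : (ℕ →ᵇ ℂ) →L[ℂ] (ℕ →ᵇ ℂ) :=
  kernelOp hγ (hP.weightBounded_interior hγ) (phi_pos hP.a_nonneg hP.a_left hγ).le

lemma IsWalk.toSeq_interiorOp (hP : IsWalk P c g d a) (hγ : 0 < γ) (h : ℕ →ᵇ ℂ) (i : ℕ) :
    toSeq γ (hP.interiorOp hγ h) i = if g ≤ i then act P (toSeq γ h) i else 0 := by
  rw [interiorOp, toSeq_kernelOp, act_interiorKernel]

lemma IsWalk.norm_interiorOp_le (hP : IsWalk P c g d a) (hγ : 0 < γ) :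
    ‖hP.interiorOp hγ‖ ≤ phi g d a γ := by
  unfold interiorOp
  exact norm_kernelOp_le _ _ _

instance : Nontrivial (ℕ →ᵇ ℂ) :=
  ⟨⟨0, BoundedContinuousFunction.const ℕ 1, fun h => by
    simpa using congrArg (fun f : ℕ →ᵇ ℂ => f 0) h⟩⟩

lemma IsWalk.mem_resolventSet (hP : IsWalk P c g d a) (hγ : 0 < γ) {lam : ℂ}
    (hlam : phi g d a γ < ‖lam‖) : lam ∈ resolventSet ℂ (hP.interiorOp hγ) := by
  have h : ‖hP.interiorOp hγ‖ < ‖lam‖ := (hP.norm_interiorOp_le hγ).trans_lt hlam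
  generalize hP.interiorOp hγ = A at h
  exact spectrum.mem_resolventSet_of_norm_lt (𝕜 := ℂ) (A := (ℕ →ᵇ ℂ) →L[ℂ] (ℕ →ᵇ ℂ)) h

/-- The sequence with prescribed values on `{0, …, g-1}` and `0` elsewhere, in weighted form. -/
def initial (γ : ℝ) (v : Fin g → ℂ) : ℕ →ᵇ ℂ :=
  ∑ j : Fin g, (v j / (γ : ℂ) ^ (j : ℕ)) •
    BoundedContinuousFunction.ofNormedAddCommGroupDiscrete
      (fun n : ℕ => if n = (j : ℕ) then (1 : ℂ) else 0) 1
      (fun n => by split_ifs <;> simp)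

lemma initial_eq_sum (v : Fin g → ℂ) :
    initial γ v = ∑ j, v j • initial γ (Pi.single j (1 : ℂ)) := by
  unfold initial
  refine Finset.sum_congr rfl fun j _ => ?_
  rw [Finset.sum_eq_single_of_mem j (Finset.mem_univ j)]
  · rw [smul_smul, Pi.single_eq_same]
    congr 1
    ring
  · intro i _ hi
    rw [Pi.single_eq_of_ne hi, zero_div, zero_smul]

lemma toSeq_initial (hγ : 0 < γ) (v : Fin g → ℂ) (n : ℕ) :
    toSeq γ (initial γ v) n = if h : n < g then v ⟨n, h⟩ else 0 := by
  have hγ' : (γ : ℂ) ≠ 0 := Complex.ofReal_ne_zero.2 hγ.ne'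
  have key : initial γ v n =
      ∑ j : Fin g, v j / (γ : ℂ) ^ (j : ℕ) * if n = j then (1 : ℂ) else 0 := by
    simp only [initial, BoundedContinuousFunction.sum_apply,
      BoundedContinuousFunction.coe_smul, BoundedContinuousFunction.coe_ofNormedAddCommGroupDiscrete, smul_eq_mul]
  rw [toSeq_apply, key]
  split_ifs with h
  · rw [Finset.sum_eq_single_of_mem ⟨n, h⟩ (Finset.mem_univ _)]
    · simp only [if_true, mul_one]
      exact mul_div_cancel₀ _ (pow_ne_zero _ hγ')
    · intro j _ hj
      rw [if_neg fun hn => hj (Fin.ext hn.symm), mul_zero]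
  · rw [Finset.sum_eq_zero, mul_zero]
    intro j _
    rw [if_neg (by have := j.2; omega), mul_zero]

/-- The weighted solution `(λ - T)⁻¹ v` for `v` supported on the boundary. -/
def IsWalk.solve (hP : IsWalk P c g d a) (hγ : 0 < γ) (lam : ℂ) (v : Fin g → ℂ) : ℕ →ᵇ ℂ :=
  resolvent (hP.interiorOp hγ) lam (initial γ v)

lemma IsWalk.solve_eq_sum (hP : IsWalk P c g d a) (hγ : 0 < γ) (lam : ℂ) (v : Fin g → ℂ) :
    hP.solve hγ lam v = ∑ j, v j • hP.solve hγ lam (Pi.single j (1 : ℂ)) := by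
  rw [solve, initial_eq_sum, map_sum]
  exact Finset.sum_congr rfl fun j _ => map_smul _ _ _

lemma IsWalk.solve_spec (hP : IsWalk P c g d a) (hγ : 0 < γ) {lam : ℂ}
    (hlam : phi g d a γ < ‖lam‖) (v : Fin g → ℂ) :
    lam • hP.solve hγ lam v - hP.interiorOp hγ (hP.solve hγ lam v) = initial γ v := by
  have h : (algebraMap ℂ ((ℕ →ᵇ ℂ) →L[ℂ] (ℕ →ᵇ ℂ)) lam - hP.interiorOp hγ) *
      resolvent (hP.interiorOp hγ) lam = 1 :=
    Ring.mul_inverse_cancel _ (hP.mem_resolventSet hγ hlam)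
  have := congrArg (fun A => A (initial γ v)) h
  simpa [Algebra.algebraMap_eq_smul_one, solve] using this

lemma IsWalk.solve_apply (hP : IsWalk P c g d a) (hγ : 0 < γ) {lam : ℂ}
    (hlam : phi g d a γ < ‖lam‖) (v : Fin g → ℂ) (i : ℕ) :
    lam * toSeq γ (hP.solve hγ lam v) i = (if g ≤ i then act P (toSeq γ (hP.solve hγ lam v)) i
      else 0) + if h : i < g then v ⟨i, h⟩ else 0 := by
  have := congrFun (congrArg (toSeq γ) (hP.solve_spec hγ hlam v)) i
  rw [map_sub, map_smul, Pi.sub_apply, Pi.smul_apply, toSeq_initial hγ, hP.toSeq_interiorOp,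
    smul_eq_mul] at this
  rw [← this]
  ring

lemma IsWalk.solve_interior (hP : IsWalk P c g d a) (hγ : 0 < γ) {lam : ℂ}
    (hlam : phi g d a γ < ‖lam‖) (v : Fin g → ℂ) {i : ℕ} (hi : g ≤ i) :
    act P (toSeq γ (hP.solve hγ lam v)) i = lam * toSeq γ (hP.solve hγ lam v) i := by
  rw [hP.solve_apply hγ hlam, if_pos hi, dif_neg (by omega), add_zero]

lemma IsWalk.solve_boundary (hP : IsWalk P c g d a) (hγ : 0 < γ) {lam : ℂ}
    (hlam : phi g d a γ < ‖lam‖) (v : Fin g → ℂ) (i : Fin g) :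
    lam * toSeq γ (hP.solve hγ lam v) i = v i := by
  rw [hP.solve_apply hγ hlam, if_neg (by have := i.2; omega), dif_pos i.2, zero_add]

lemma IsWalk.solve_mem (hP : IsWalk P c g d a) (hγ : 0 < γ) {lam : ℂ}
    (hlam : phi g d a γ < ‖lam‖) (v : Fin g → ℂ) :
    toSeq γ (hP.solve hγ lam v) ∈ interiorSolutions g d a γ lam :=
  hP.mem_interiorSolutions.2 ⟨toSeq_mem_growth hγ _, fun _ hi => hP.solve_interior hγ hlam v hi⟩

/-- Since $T$ has zero boundary rows, $(\lambda-T)f$ equals $\lambda f(i)$ for $i<g$ and vanishes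
elsewhere for an interior solution; inverting $\lambda-T$ recovers $f$. -/
lemma IsWalk.eq_solve (hP : IsWalk P c g d a) (hγ : 0 < γ) {lam : ℂ}
    (hlam : phi g d a γ < ‖lam‖) {f : ℕ → ℂ} (hf : f ∈ interiorSolutions g d a γ lam) :
    toSeq γ (hP.solve hγ lam fun i => lam * f i) = f := by
  obtain ⟨⟨C, hC⟩, hint⟩ := hP.mem_interiorSolutions.1 hf
  obtain ⟨h, rfl, -⟩ := exists_toSeq_eq hγ hC
  have h1 : resolvent (hP.interiorOp hγ) lam *
      (algebraMap ℂ ((ℕ →ᵇ ℂ) →L[ℂ] (ℕ →ᵇ ℂ)) lam - hP.interiorOp hγ) = 1 :=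
    Ring.inverse_mul_cancel _ (hP.mem_resolventSet hγ hlam)
  have h2 : initial γ (fun i : Fin g => lam * toSeq γ h i) =
      lam • h - hP.interiorOp hγ h := by
    refine toSeq_injective hγ ?_
    ext i
    rw [toSeq_initial hγ, map_sub, map_smul, Pi.sub_apply, Pi.smul_apply, smul_eq_mul,
      hP.toSeq_interiorOp]
    split_ifs with h3 h4 h4
    · omega
    · rw [sub_zero]
    · rw [hint i h4, sub_self]
    · omega
  have h3 := congrArg (fun A => A h) h1
  rw [solve, h2]
  exact congrArg (toSeq γ) h3

/-- Restriction to `{0, …, g-1}` identifies the interior solutions with `ℂ^g`. -/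
def IsWalk.interiorSolutionsEquiv (hP : IsWalk P c g d a) (hγ : 0 < γ) {lam : ℂ}
    (hlam : phi g d a γ < ‖lam‖) : interiorSolutions g d a γ lam ≃ₗ[ℂ] (Fin g → ℂ) :=
  LinearEquiv.ofBijective
    ((LinearMap.funLeft ℂ ℂ (fun i : Fin g => (i : ℕ))).comp
      (interiorSolutions g d a γ lam).subtype) (by
    have hlam0 : lam ≠ 0 := norm_pos_iff.1 ((phi_pos hP.a_nonneg hP.a_left hγ).trans hlam)
    constructor
    · rintro ⟨f, hf⟩ ⟨f', hf'⟩ h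
      have : ∀ i : Fin g, f i = f' i := fun i => congrFun h i
      ext1
      change f = f'
      rw [← hP.eq_solve hγ hlam hf, ← hP.eq_solve hγ hlam hf']
      simp only [this]
    · intro v
      -- The boundary rows of $(\lambda-T)f=w$ read $\lambda f(i)=w_i$, hence the datum $\lambda v$;
      -- this uses $\lambda\ne0$.
      refine ⟨⟨_, hP.solve_mem hγ hlam fun i => lam * v i⟩, ?_⟩
      ext i
      exact mul_left_cancel₀ hlam0 (hP.solve_boundary hγ hlam _ i))

/-! ### The small roots -/

/-- The roots of `E_λ` of modulus `< γ`, with multiplicities. -/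
def smallMultiset (g d : ℕ) (a : ℤ → ℝ) (γ : ℝ) (lam : ℂ) : Multiset ℂ := by
  classical exact (charPoly g d a lam).roots.filter fun z => ‖z‖ < γ

lemma card_smallMultiset (lam : ℂ) :
    (smallMultiset g d a γ lam).card = numSmall g d a γ lam := by
  classical
  rw [numSmall, ← Multiset.toFinset_sum_count_eq]
  have h : (smallMultiset g d a γ lam).toFinset = smallRoots g d a γ lam := by
    ext z
    simp [smallMultiset, smallRoots]
  rw [h]
  refine Finset.sum_congr rfl fun z hz => ?_
  have hz' : ‖z‖ < γ := by
    simp only [smallRoots, Finset.mem_filter] at hz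
    exact hz.2
  rw [mult, ← count_roots, smallMultiset, Multiset.count_filter, if_pos hz']

/-- The monic polynomial whose roots are the small roots of `E_λ`. -/
def smallPoly (g d : ℕ) (a : ℤ → ℝ) (γ : ℝ) (lam : ℂ) : ℂ[X] :=
  ((smallMultiset g d a γ lam).map fun z => X - C z).prod

lemma monic_smallPoly (lam : ℂ) : (smallPoly g d a γ lam).Monic :=
  monic_multiset_prod_of_monic _ _ fun z _ => monic_X_sub_C z

lemma natDegree_smallPoly (lam : ℂ) :
    (smallPoly g d a γ lam).natDegree = numSmall g d a γ lam := by
  rw [smallPoly, natDegree_multiset_prod_X_sub_C_eq_card, card_smallMultiset]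

/-- Split $E_\lambda$ over $\mathbb C$. No root has modulus $\gamma$, and the factor of the roots
outside the disc acts injectively on $O(\gamma^n)$, so it can be cancelled from the recurrence. -/
lemma IsWalk.aeval_smallPoly (hP : IsWalk P c g d a) (hγ : 0 < γ) {lam : ℂ}
    (hlam : phi g d a γ < ‖lam‖) {f : ℕ → ℂ} (hf : f ∈ interiorSolutions g d a γ lam) :
    aeval shift (smallPoly g d a γ lam) f = 0 := by
  classical
  obtain ⟨hf1, hf2⟩ := hf
  set R := (charPoly g d a lam).roots
  have hsplit : charPoly g d a lam = C (charPoly g d a lam).leadingCoeff *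
      (((R.filter fun z => ¬ ‖z‖ < γ).map fun z => X - C z).prod * smallPoly g d a γ lam) := by
    rw [smallPoly, smallMultiset, ← Multiset.prod_add, ← Multiset.map_add, add_comm,
      Multiset.filter_add_not]
    exact (IsAlgClosed.splits _).eq_prod_roots
  have h1 : aeval shift (charPoly g d a lam) f = 0 := hf2
  rw [hsplit, aeval_shift_mul, aeval_C, Module.algebraMap_end_apply, smul_eq_zero,
    or_iff_right (leadingCoeff_ne_zero.2 (hP.charPoly_ne_zero lam)), aeval_shift_mul] at h1
  refine eq_zero_of_aeval_prod_eq_zero hγ _ (fun z hz => ?_) (aeval_shift_mem_growth _ hf1) h1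
  rw [Multiset.mem_filter] at hz
  exact lt_of_le_of_ne (not_lt.1 hz.2) (hP.norm_ne_of_mem_roots hlam hz.1).symm

lemma mem_smallRoots {lam z : ℂ} :
    z ∈ smallRoots g d a γ lam ↔ z ∈ (charPoly g d a lam).roots ∧ ‖z‖ < γ := by
  simp [smallRoots]

lemma IsWalk.zseq_mem (hP : IsWalk P c g d a) (hγ : 0 < γ) {lam z : ℂ}
    (hz : z ∈ smallRoots g d a γ lam) {k : ℕ} (hk : k ∈ Finset.Icc 1 (mult g d a lam z)) :
    zseq z k ∈ interiorSolutions g d a γ lam := by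
  rw [mem_smallRoots] at hz
  rw [Finset.mem_Icc] at hk
  refine ⟨mem_growth_of_tendsto hγ
    (tendsto_zseq hγ (hP.ne_zero_of_mem_roots hz.1) hz.2 k), ?_⟩
  obtain ⟨q, hq⟩ := pow_rootMultiplicity_dvd (charPoly g d a lam) z
  change aeval shift (charPoly g d a lam) (zseq z k) = 0
  rw [hq, mul_comm, aeval_shift_mul, ← mult, aeval_X_sub_C_pow_zseq z _ hk.1 hk.2, map_zero]

/-- Index set of the sequences `z^{(k)}`, `z` a small root, `1 ≤ k ≤ m_z`. -/
abbrev SmallIndex (g d : ℕ) (a : ℤ → ℝ) (γ : ℝ) (lam : ℂ) : Type :=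
  Σ z : smallRoots g d a γ lam, Fin (mult g d a lam z)

lemma card_smallIndex (lam : ℂ) :
    Fintype.card (SmallIndex g d a γ lam) = numSmall g d a γ lam := by
  rw [Fintype.card_sigma, numSmall]
  simp only [Fintype.card_fin]
  exact Finset.sum_coe_sort (smallRoots g d a γ lam) (mult g d a lam)

/-- The sequences `z^{(k)}` as interior solutions. -/
def IsWalk.zseqSolution (hP : IsWalk P c g d a) (hγ : 0 < γ) (lam : ℂ)
    (q : SmallIndex g d a γ lam) : interiorSolutions g d a γ lam :=
  ⟨zseq q.1 (q.2 + 1), hP.zseq_mem hγ q.1.2 (Finset.mem_Icc.2 ⟨by omega, q.2.2⟩)⟩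

lemma sum_Icc_one_eq {M : Type*} [AddCommMonoid M] (m : ℕ) (F : ℕ → M) :
    ∑ k ∈ Finset.Icc 1 m, F k = ∑ k : Fin m, F (k + 1) := by
  rw [Fin.sum_univ_eq_sum_range (fun k => F (k + 1)), Finset.range_eq_Ico,
    Finset.sum_Ico_add' F 0 m 1]
  rfl

lemma sum_smallIndex {M : Type*} [AddCommMonoid M] (lam : ℂ) (F : ℂ → ℕ → M) :
    ∑ z ∈ smallRoots g d a γ lam, ∑ k ∈ Finset.Icc 1 (mult g d a lam z), F z k =
      ∑ q : SmallIndex g d a γ lam, F q.1 (q.2 + 1) := by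
  rw [Fintype.sum_sigma, ← Finset.sum_coe_sort]
  exact Finset.sum_congr rfl fun z _ => sum_Icc_one_eq _ _

lemma IsWalk.linearIndependent_zseq (hP : IsWalk P c g d a) (hγ : 0 < γ) (lam : ℂ) :
    LinearIndependent ℂ (hP.zseqSolution hγ lam) := by
  classical
  rw [Fintype.linearIndependent_iff]
  intro β hβ q
  set α : ℂ → ℕ → ℂ := fun z k => if h : z ∈ smallRoots g d a γ lam ∧
    k - 1 < mult g d a lam z then β ⟨⟨z, h.1⟩, ⟨k - 1, h.2⟩⟩ else 0
  have hα : ∀ q : SmallIndex g d a γ lam, α q.1 (q.2 + 1) = β q := fun q =>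
    dif_pos ⟨q.1.2, by simp⟩
  have h := zseq_independent (smallRoots g d a γ lam) (mult g d a lam) α (fun n => by
    rw [sum_smallIndex lam (fun z k => α z k * zseq z k n)]
    have := congrFun (congrArg Subtype.val hβ) n
    simp only [hα]
    simpa [zseqSolution] using this)
  rw [← hα]
  exact h _ q.1.2 _ (Finset.mem_Icc.2 ⟨by omega, q.2.2⟩)

/-- The space of interior solutions has dimension $g$ by the resolvent description. The independent
sequences $z^{(k)}$ in it give `≤`; the monic recurrence of order $N(\lambda)$ satisfied by all its
elements gives `≥`. -/
lemma IsWalk.numSmall_eq (hP : IsWalk P c g d a) (hγ : 0 < γ) {lam : ℂ}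
    (hlam : phi g d a γ < ‖lam‖) : numSmall g d a γ lam = g := by
  obtain ⟨e⟩ : Nonempty (interiorSolutions g d a γ lam ≃ₗ[ℂ] (Fin g → ℂ)) :=
    ⟨hP.interiorSolutionsEquiv hγ hlam⟩
  have : FiniteDimensional ℂ (interiorSolutions g d a γ lam) :=
    Module.Finite.equiv e.symm
  have hfin : Module.finrank ℂ (interiorSolutions g d a γ lam) = g := by
    rw [e.finrank_eq, Module.finrank_fin_fun]
  apply le_antisymm
  · have h := (hP.linearIndependent_zseq hγ lam).fintype_card_le_finrank
    rwa [card_smallIndex, hfin] at h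
  · set n := numSmall g d a γ lam
    let ev : interiorSolutions g d a γ lam →ₗ[ℂ] (Fin n → ℂ) :=
      (LinearMap.funLeft ℂ ℂ (fun i : Fin n => (i : ℕ))).comp
        (interiorSolutions g d a γ lam).subtype
    have hinj : Function.Injective ev := by
      rw [injective_iff_map_eq_zero]
      rintro ⟨f, hf⟩ h
      ext1
      refine eq_zero_of_monic_recurrence (monic_smallPoly lam) (hP.aeval_smallPoly hγ hlam hf) ?_
      intro i hi
      rw [natDegree_smallPoly] at hi
      exact congrFun h ⟨i, hi⟩
    have := LinearMap.finrank_le_finrank_of_injective hinj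
    rwa [hfin, Module.finrank_fin_fun] at this

/-- There are as many independent $z^{(k)}$ as the dimension, so they span. -/
lemma IsWalk.exists_eq_sum_zseq (hP : IsWalk P c g d a) (hγ : 0 < γ) {lam : ℂ}
    (hlam : phi g d a γ < ‖lam‖) {f : ℕ → ℂ} (hf : f ∈ interiorSolutions g d a γ lam) :
    ∃ α : ℂ → ℕ → ℂ, f = fun n => ∑ z ∈ smallRoots g d a γ lam,
      ∑ k ∈ Finset.Icc 1 (mult g d a lam z), α z k * zseq z k n := by
  classical
  obtain ⟨e⟩ : Nonempty (interiorSolutions g d a γ lam ≃ₗ[ℂ] (Fin g → ℂ)) :=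
    ⟨hP.interiorSolutionsEquiv hγ hlam⟩
  have : FiniteDimensional ℂ (interiorSolutions g d a γ lam) :=
    Module.Finite.equiv e.symm
  have hspan := (hP.linearIndependent_zseq hγ lam).span_eq_top_of_card_eq_finrank' (by
    rw [card_smallIndex, hP.numSmall_eq hγ hlam, e.finrank_eq, Module.finrank_fin_fun])
  have hmem : (⟨f, hf⟩ : interiorSolutions g d a γ lam) ∈
      Submodule.span ℂ (Set.range (hP.zseqSolution hγ lam)) := by
    rw [hspan]; trivial
  obtain ⟨β, hβ⟩ := (Submodule.mem_span_range_iff_exists_fun ℂ).1 hmem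
  set α : ℂ → ℕ → ℂ := fun z k => if h : z ∈ smallRoots g d a γ lam ∧
    k - 1 < mult g d a lam z then β ⟨⟨z, h.1⟩, ⟨k - 1, h.2⟩⟩ else 0
  have hα : ∀ q : SmallIndex g d a γ lam, α q.1 (q.2 + 1) = β q := fun q =>
    dif_pos ⟨q.1.2, by simp⟩
  refine ⟨α, ?_⟩
  ext n
  rw [sum_smallIndex lam (fun z k => α z k * zseq z k n)]
  have := congrFun (congrArg Subtype.val hβ) n
  simp only [hα]
  simpa [zseqSolution] using this.symm

/-- For interior solutions $O(\gamma^n)$ improves to $o(\gamma^n)$, because only finitely many roots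
occur and all lie strictly inside the disc. The maximum principle needs this gain. -/
lemma IsWalk.tendsto_of_mem_interiorSolutions (hP : IsWalk P c g d a) (hγ : 0 < γ) {lam : ℂ}
    (hlam : phi g d a γ < ‖lam‖) {f : ℕ → ℂ} (hf : f ∈ interiorSolutions g d a γ lam) :
    Filter.Tendsto (fun n => ‖f n‖ / γ ^ n) Filter.atTop (nhds 0) := by
  obtain ⟨α, rfl⟩ := hP.exists_eq_sum_zseq hγ hlam hf
  have h : Filter.Tendsto (fun n => ∑ z ∈ smallRoots g d a γ lam,
      ∑ k ∈ Finset.Icc 1 (mult g d a lam z), ‖α z k‖ * (‖zseq z k n‖ / γ ^ n))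
      Filter.atTop (nhds 0) := by
    rw [show (0 : ℝ) = ∑ z ∈ smallRoots g d a γ lam,
      ∑ k ∈ Finset.Icc 1 (mult g d a lam z), ‖α z k‖ * 0 by simp]
    refine tendsto_finsetSum _ fun z hz => tendsto_finsetSum _ fun k _ => ?_
    rw [mem_smallRoots] at hz
    exact (tendsto_zseq hγ (hP.ne_zero_of_mem_roots hz.1) hz.2 k).const_mul _
  refine squeeze_zero (fun n => by positivity) (fun n => ?_) h
  rw [div_le_iff₀ (by positivity), Finset.sum_mul]
  refine (norm_sum_le _ _).trans (Finset.sum_le_sum fun z _ => ?_)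
  rw [Finset.sum_mul]
  refine (norm_sum_le _ _).trans (Finset.sum_le_sum fun k _ => ?_)
  rw [norm_mul, mul_assoc, div_mul_cancel₀]
  positivity

/-- The boundary condition characterises the eigenvalues of `P` on sequences `O(γ^n)`. -/
lemma IsWalk.boundaryCondition_iff (hP : IsWalk P c g d a) (hγ : 0 < γ) {lam : ℂ}
    (hlam : phi g d a γ < ‖lam‖) : BoundaryCondition P g d a γ lam ↔
      ∃ f ∈ growth γ, f ≠ 0 ∧ ∀ i, act P f i = lam * f i := by
  constructor
  · rintro ⟨α, ⟨z, hz, k, hk, hne⟩, hb⟩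
    set f : ℕ → ℂ := fun n => ∑ z ∈ smallRoots g d a γ lam,
      ∑ k ∈ Finset.Icc 1 (mult g d a lam z), α z k * zseq z k n
    have hf : f ∈ interiorSolutions g d a γ lam := by
      have : f = ∑ z ∈ smallRoots g d a γ lam,
          ∑ k ∈ Finset.Icc 1 (mult g d a lam z), α z k • zseq z k := by
        ext n; simp [f]
      rw [this]
      exact Submodule.sum_mem _ fun z hz => Submodule.sum_mem _ fun k hk =>
        Submodule.smul_mem _ _ (hP.zseq_mem hγ hz hk)
    rw [hP.mem_interiorSolutions] at hf
    refine ⟨f, hf.1, fun h0 => hne ?_, fun i => ?_⟩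
    · exact zseq_independent _ _ α (fun n => congrFun h0 n) z hz k hk
    · rcases lt_or_ge i g with hi | hi
      · exact (hb i hi).symm
      · exact hf.2 i hi
  · rintro ⟨f, hf, hne, heig⟩
    obtain ⟨α, hα⟩ := hP.exists_eq_sum_zseq hγ hlam
      (hP.mem_interiorSolutions.2 ⟨hf, fun i _ => heig i⟩)
    refine ⟨α, ?_, fun i _ => ?_⟩
    · by_contra! hcon
      refine hne (hα.trans ?_)
      ext n
      exact Finset.sum_eq_zero fun z hz => Finset.sum_eq_zero fun k hk => by
        rw [hcon z hz k hk, zero_mul]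
    · rw [← hα]
      exact (heig i).symm

end Solutions

/-! ### Eigenvalues of modulus at least one -/

section Peripheral

variable {P : ℕ → ℕ → ℝ} {c g d : ℕ} {a : ℤ → ℝ} {γ : ℝ}

lemma step_nonneg (hP : ∀ i j, 0 ≤ P i j) (n i j : ℕ) : 0 ≤ step P n i j := by
  induction n generalizing i with
  | zero => rw [step]; split_ifs <;> norm_num
  | succ n ih => exact tsum_nonneg fun k => mul_nonneg (hP i k) (ih k)

/-- Maximum principle: an eigensequence `f = o(γ^n)` for an eigenvalue of modulus at least one
attains its maximal modulus. -/
lemma IsWalk.exists_forall_norm_le (hP : IsWalk P c g d a) (hγ : 1 < γ) (hδ : phi g d a γ < 1)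
    {lam : ℂ} (hlam : 1 ≤ ‖lam‖) {f : ℕ → ℂ}
    (hf : Filter.Tendsto (fun n => ‖f n‖ / γ ^ n) Filter.atTop (nhds 0))
    (heig : ∀ i, g ≤ i → act P f i = lam * f i) : ∃ i, ∀ n, ‖f n‖ ≤ ‖f i‖ := by
  have hγ0 : 0 < γ := by linarith
  obtain ⟨i₀, hi₀, hmax⟩ := Finset.exists_max_image (Finset.range g) (fun i => ‖f i‖)
    ⟨0, Finset.mem_range.2 hP.g_pos⟩
  refine ⟨i₀, ?_⟩
  by_contra! hcon
  obtain ⟨n, hn⟩ := hcon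
  obtain ⟨ε, hε, hεn⟩ : ∃ ε > 0, ‖f i₀‖ < ‖f n‖ - ε * γ ^ n := by
    refine ⟨(‖f n‖ - ‖f i₀‖) / (2 * γ ^ n), ?_, ?_⟩
    · have : 0 < ‖f n‖ - ‖f i₀‖ := sub_pos.2 hn
      positivity
    · have : (‖f n‖ - ‖f i₀‖) / (2 * γ ^ n) * γ ^ n = (‖f n‖ - ‖f i₀‖) / 2 := by field_simp
      rw [this]; linarith
  -- Subtracting $\varepsilon\gamma^m$ makes the function eventually nonpositive, so it attains a
  -- maximum, and $\varepsilon$ is small enough that this maximum still exceeds every boundary value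
  -- of $|f|$.
  set u : ℕ → ℝ := fun m => ‖f m‖ - ε * γ ^ m
  have hev : ∀ᶠ m in Filter.atTop, u m ≤ 0 := by
    filter_upwards [hf.eventually (gt_mem_nhds hε)] with m hm
    rw [div_lt_iff₀ (by positivity)] at hm
    exact sub_nonpos.2 hm.le
  obtain ⟨N, hN⟩ := Filter.eventually_atTop.1 hev
  obtain ⟨m, -, hm⟩ := Finset.exists_max_image (Finset.range (max N (n + 1))) u
    ⟨n, Finset.mem_range.2 (lt_of_lt_of_le (Nat.lt_succ_self n) (le_max_right _ _))⟩
  have hnm : ‖f i₀‖ < u m := lt_of_lt_of_le hεn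
    (hm n (Finset.mem_range.2 (lt_of_lt_of_le (Nat.lt_succ_self n) (le_max_right _ _))))
  have hum : ∀ k, u k ≤ u m := fun k => by
    by_cases hk : k < max N (n + 1)
    · exact hm k (Finset.mem_range.2 hk)
    · exact (hN k ((le_max_left _ _).trans (not_lt.1 hk))).trans ((norm_nonneg _).trans hnm.le)
  have hgm : g ≤ m := by
    by_contra! h
    have h1 := hmax m (Finset.mem_range.2 h)
    have h2 : 0 < ε * γ ^ m := by positivity
    simp only [u] at hnm
    linarith
  have h1 : ‖f m‖ ≤ ‖act P f m‖ := by
    rw [heig m hgm, norm_mul]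
    nlinarith [norm_nonneg (f m)]
  -- At the interior maximum $m$, averaging $|f|=u+\varepsilon\gamma^{\cdot}$ costs only the factor
  -- $\varphi(\gamma)<1$ on the penalty, whereas $|f(m)|=u(m)+\varepsilon\gamma^m$: a contradiction.
  have h2 : ‖act P f m‖ ≤ u m + ε * (phi g d a γ * γ ^ m) := by
    rw [hP.act_interior f hgm, phi, Finset.sum_mul, Finset.mul_sum,
      show u m = ∑ k ∈ Finset.Icc (-(g : ℤ)) d, a k * u m by
        rw [← Finset.sum_mul, hP.a_sum, one_mul], ← Finset.sum_add_distrib]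
    refine (norm_sum_le _ _).trans (Finset.sum_le_sum fun k hk => ?_)
    have ha := hP.a_nonneg k hk
    rw [norm_mul, Complex.norm_real, Real.norm_of_nonneg ha]
    have h3 := mul_le_mul_of_nonneg_left (hum ((m : ℤ) + k).toNat) ha
    have h4 : γ ^ ((m : ℤ) + k).toNat = γ ^ k * γ ^ m := by
      rw [Finset.mem_Icc] at hk
      rw [← zpow_natCast, ← zpow_natCast, ← zpow_add₀ hγ0.ne']
      congr 1
      omega
    simp only [u, h4] at h3 ⊢
    linarith
  have h5 : 0 < ε * γ ^ m := by positivity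
  have h6 : ε * (phi g d a γ * γ ^ m) < ε * γ ^ m := by nlinarith
  simp only [u] at h2
  linarith

/-- Equality case of averaging: $w=\lambda f(i)$ is a mean of values of modulus at most $|w|$. The
nonnegative quantities $|w|^2-\mathrm{Re}(f(k)\bar w)$ have mean zero and control $|f(k)-w|^2$. -/
lemma IsMarkov.eq_of_norm_max (hP : IsMarkov P) {lam : ℂ} (hlam : 1 ≤ ‖lam‖) {f : ℕ → ℂ} {i : ℕ}
    (hmax : ∀ n, ‖f n‖ ≤ ‖f i‖) (heig : act P f i = lam * f i) {j : ℕ} (hj : 0 < P i j) :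
    f j = lam * f i := by
  set w := lam * f i
  have hw : ∀ n, ‖f n‖ ≤ ‖w‖ := fun n => (hmax n).trans (by
    rw [norm_mul]; nlinarith [norm_nonneg (f i)])
  have hsum : HasSum (fun k => (P i k : ℂ) * f k) w := by
    rw [← heig]
    refine Summable.hasSum (Summable.of_norm_bounded ((hP.2 i).summable.mul_right ‖w‖) fun k => ?_)
    rw [norm_mul, Complex.norm_real, Real.norm_of_nonneg (hP.1 i k)]
    exact mul_le_mul_of_nonneg_left (hw k) (hP.1 i k)
  have hre : HasSum (fun k => P i k * (‖w‖ ^ 2 - (f k * starRingEnd ℂ w).re)) 0 := by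
    have h1 := Complex.hasSum_re (hsum.mul_right (starRingEnd ℂ w))
    have h2 := ((hP.2 i).mul_right (‖w‖ ^ 2)).sub h1
    have e : 1 * ‖w‖ ^ 2 - (w * starRingEnd ℂ w).re = 0 := by
      rw [Complex.mul_conj, Complex.ofReal_re, Complex.normSq_eq_norm_sq]
      ring
    rw [e] at h2
    have ef : (fun k => P i k * (‖w‖ ^ 2 - (f k * starRingEnd ℂ w).re)) =
        fun k => P i k * ‖w‖ ^ 2 - ((P i k : ℂ) * f k * starRingEnd ℂ w).re := by
      ext k
      rw [mul_assoc, Complex.re_ofReal_mul]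
      ring
    rw [ef]
    exact h2
  have hterm : ∀ k, ‖f k - w‖ ^ 2 ≤ 2 * (‖w‖ ^ 2 - (f k * starRingEnd ℂ w).re) := fun k => by
    rw [← Complex.normSq_eq_norm_sq, Complex.normSq_sub, Complex.normSq_eq_norm_sq,
      Complex.normSq_eq_norm_sq]
    have := pow_le_pow_left₀ (norm_nonneg _) (hw k) 2
    linarith
  have hnn : ∀ k, 0 ≤ P i k * (‖w‖ ^ 2 - (f k * starRingEnd ℂ w).re) := fun k =>
    mul_nonneg (hP.1 i k) (by nlinarith [hterm k, sq_nonneg ‖f k - w‖])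
  have h0 := congrFun ((hasSum_zero_iff_of_nonneg hnn).1 hre) j
  have h1 : ‖w‖ ^ 2 - (f j * starRingEnd ℂ w).re = 0 := (mul_eq_zero.1 h0).resolve_left hj.ne'
  have h2 := hterm j
  rw [h1, mul_zero] at h2
  exact sub_eq_zero.1 (norm_eq_zero.1 (pow_eq_zero_iff two_ne_zero |>.1
    (le_antisymm h2 (sq_nonneg _))))

lemma IsMarkov.exists_pos (hP : IsMarkov P) (i : ℕ) : ∃ j, 0 < P i j := by
  by_contra! h
  have h0 : P i = 0 := funext fun j => le_antisymm (h j) (hP.1 i j)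
  have h1 := hP.2 i
  rw [h0] at h1
  exact zero_ne_one (hasSum_zero.unique h1)

/-- Since $|\lambda|=1$, each state reached from a point of maximal modulus is again one, so the
equality case propagates along paths. -/
lemma IsMarkov.eq_pow_mul_of_step_pos (hP : IsMarkov P) {lam : ℂ} (hlam : ‖lam‖ = 1) {f : ℕ → ℂ}
    (heig : ∀ i, act P f i = lam * f i) (n : ℕ) {i j : ℕ} (hmax : ∀ n, ‖f n‖ ≤ ‖f i‖)
    (hj : 0 < step P n i j) : f j = lam ^ n * f i := by
  induction n generalizing i with
  | zero =>
    rw [step] at hj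
    split_ifs at hj with h
    · rw [h, pow_zero, one_mul]
    · exact absurd hj (lt_irrefl 0)
  | succ n ih =>
    obtain ⟨k, hk⟩ : ∃ k, P i k * step P n k j ≠ 0 := by
      by_contra! h
      simp only [step, h, tsum_zero] at hj
      exact lt_irrefl 0 hj
    have h1 : 0 < P i k := lt_of_le_of_ne (hP.1 i k) (left_ne_zero_of_mul hk).symm
    have h2 : 0 < step P n k j :=
      lt_of_le_of_ne (step_nonneg hP.1 n k j) (right_ne_zero_of_mul hk).symm
    have h3 := hP.eq_of_norm_max hlam.ge hmax (heig i) h1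
    have h4 : ‖f k‖ = ‖f i‖ := by rw [h3, norm_mul, hlam, one_mul]
    rw [ih (fun m => h4 ▸ hmax m) h2, h3]
    ring

/-- For an irreducible aperiodic walk, `1` is the only eigenvalue of modulus at least one on
sequences `O(γ^n)`, and its eigensequences are constant. -/
lemma IsWalk.peripheral (hP : IsWalk P c g d a) (hirr : IsIrreducible P) (haper : IsAperiodic P)
    (hγ : 1 < γ) (hδ : phi g d a γ < 1) {lam : ℂ} (hlam : 1 ≤ ‖lam‖) {f : ℕ → ℂ}
    (hf : f ∈ growth γ) (heig : ∀ i, act P f i = lam * f i) (hne : f ≠ 0) :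
    lam = 1 ∧ ∃ x, x ≠ 0 ∧ ∀ i, f i = x := by
  have hγ0 : 0 < γ := by linarith
  obtain ⟨i, hi⟩ := hP.exists_forall_norm_le hγ hδ hlam
    (hP.tendsto_of_mem_interiorSolutions hγ0 (hδ.trans_le hlam)
      (hP.mem_interiorSolutions.2 ⟨hf, fun i _ => heig i⟩)) fun i _ => heig i
  have hfi : f i ≠ 0 := fun h => hne (funext fun n => by
    have := hi n
    rw [h, norm_zero] at this
    exact norm_le_zero_iff.1 this)
  have hlam1 : ‖lam‖ = 1 := by
    obtain ⟨j, hj⟩ := hP.markov.exists_pos i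
    have h1 := hP.markov.eq_of_norm_max hlam hi (heig i) hj
    have h2 := hi j
    rw [h1, norm_mul] at h2
    exact le_antisymm ((mul_le_iff_le_one_left (norm_pos_iff.2 hfi)).1 h2) hlam
  -- Every return time $n$ to $i$ forces $\lambda^n=1$, so the order of $\lambda$ divides all return
  -- times and aperiodicity makes it $1$.
  have hord : orderOf lam = 1 := haper i _ fun n _ hn => by
    have := hP.markov.eq_pow_mul_of_step_pos hlam1 heig n hi hn
    exact orderOf_dvd_of_pow_eq_one (mul_right_cancel₀ hfi (by rw [← this, one_mul]))
  rw [orderOf_eq_one_iff] at hord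
  refine ⟨hord, f i, hfi, fun j => ?_⟩
  obtain ⟨n, hn⟩ := hirr i j
  rw [hP.markov.eq_pow_mul_of_step_pos hlam1 heig n hi hn, hord, one_pow, one_mul]

end Peripheral

/-! ### Zeros of algebraic holomorphic functions -/

section AlgebraicZeros

/-- If the constant term of the relation is a nonzero polynomial, every zero of $G$ is one of its
roots. Otherwise the relation factors as $G\cdot q(G)=0$; the identity theorem forces $q(G)=0$ on
$U$, and the degree drops. Isolatedness of zeros alone would not exclude accumulation at the
boundary of $U$. -/
lemma finite_zeros_of_monic_relation {U : Set ℂ} (hU : IsPreconnected U) {G : ℂ → ℂ}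
    (hG : AnalyticOnNhd ℂ G U) {x : ℂ} (hx : x ∈ U) (hGx : G x ≠ 0) (n : ℕ) :
    ∀ p : ℂ[X][X], p.Monic → p.natDegree = n →
      (∀ lam ∈ U, (p.map (evalRingHom lam)).eval (G lam) = 0) → {lam ∈ U | G lam = 0}.Finite := by
  induction n with
  | zero =>
    intro p hp hn h
    rw [Polynomial.eq_one_of_monic_natDegree_zero hp hn] at h
    simpa using h x hx
  | succ n ih =>
    intro p hp hn h
    by_cases h0 : p.coeff 0 = 0
    · have hpX : p = p.divX * X := by
        conv_lhs => rw [← divX_mul_X_add p, h0, C_0, add_zero]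
      have hmon : p.divX.Monic := by
        rw [hpX] at hp
        exact Monic.of_mul_monic_right monic_X hp
      refine ih p.divX hmon (by rw [natDegree_divX_eq_natDegree_tsub_one, hn]; rfl) ?_
      have han : AnalyticOnNhd ℂ
          (fun lam => (p.divX.map (evalRingHom lam)).eval (G lam)) U := by
        have : (fun lam => (p.divX.map (evalRingHom lam)).eval (G lam)) = fun lam =>
            ∑ i ∈ Finset.range (p.divX.natDegree + 1),
              (p.divX.coeff i).eval lam * G lam ^ i := by
          ext lam
          rw [eval_eq_sum_range' (Nat.lt_succ_of_le natDegree_map_le)]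
          simp
        rw [this]
        refine Finset.analyticOnNhd_fun_sum _ fun i _ => ?_
        refine AnalyticOnNhd.mul (fun y _ => ?_) (hG.pow i)
        exact AnalyticAt.aeval_polynomial (analyticAt_id (𝕜 := ℂ)) (p.divX.coeff i)
      have hmul : ∀ lam ∈ U, G lam * (p.divX.map (evalRingHom lam)).eval (G lam) = 0 := by
        intro lam hl
        have := h lam hl
        rw [hpX, Polynomial.map_mul, eval_mul, map_X, eval_X] at this
        rw [mul_comm]
        exact this
      rcases AnalyticOnNhd.eq_zero_or_eq_zero_of_mul_eq_zero hG han hmul hU with h1 | h1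
      · exact absurd (h1 x hx) hGx
      · exact h1
    · refine ((p.coeff 0).roots.toFinset.finite_toSet).subset ?_
      rintro lam ⟨hl, hGl⟩
      have := h lam hl
      rw [hGl, ← coeff_zero_eq_eval_zero, coeff_map] at this
      simpa [h0] using this

/-- The exterior of a disc is the image of a half-plane under the exponential. -/
lemma isPreconnected_lt_norm {δ : ℝ} (hδ : 0 < δ) : IsPreconnected {lam : ℂ | δ < ‖lam‖} := by
  have h : {lam : ℂ | δ < ‖lam‖} = Complex.exp '' {w : ℂ | Real.log δ < w.re} := by
    ext lam
    constructor
    · intro hl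
      have h0 : lam ≠ 0 := norm_pos_iff.1 (hδ.trans hl)
      refine ⟨Complex.log lam, ?_, Complex.exp_log h0⟩
      rw [Set.mem_ofPred_eq, Complex.log_re]
      exact Real.log_lt_log hδ hl
    · rintro ⟨w, hw, rfl⟩
      rw [Set.mem_ofPred_eq, Complex.norm_exp]
      exact (Real.log_lt_iff_lt_exp hδ).1 hw
  rw [h]
  exact (convex_halfSpace_re_gt _).isPreconnected.image _ Complex.continuous_exp.continuousOn

end AlgebraicZeros

/-! ### Finiteness of the set of eigenvalues -/

section Finiteness

open scoped BoundedContinuousFunction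

variable {P : ℕ → ℕ → ℝ} {c g d : ℕ} {a : ℤ → ℝ} {γ : ℝ}

/-- The matrix `λ (1 - M(λ))`, where column `j` of `M(λ)` gives the boundary values of
`P (λ - T)⁻¹ e_j`. -/
def IsWalk.boundaryMatrix (hP : IsWalk P c g d a) (hγ : 0 < γ) (lam : ℂ) :
    Matrix (Fin g) (Fin g) ℂ :=
  Matrix.of fun i j => (if i = j then lam else 0) -
    lam * act P (toSeq γ (hP.solve hγ lam (Pi.single j 1))) i

lemma IsWalk.boundaryMatrix_mulVec (hP : IsWalk P c g d a) (hγ : 0 < γ) (lam : ℂ)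
    (v : Fin g → ℂ) (i : Fin g) :
    (hP.boundaryMatrix hγ lam).mulVec v i =
      lam * (v i - act P (toSeq γ (hP.solve hγ lam v)) i) := by
  have h : act P (toSeq γ (hP.solve hγ lam v)) i =
      ∑ j, v j * act P (toSeq γ (hP.solve hγ lam (Pi.single j 1))) i := by
    simp only [hP.act_boundary _ i.2]
    rw [hP.solve_eq_sum, map_sum]
    simp only [Finset.mul_sum, map_smul, Finset.sum_apply, Pi.smul_apply, smul_eq_mul]
    rw [Finset.sum_comm]
    exact Finset.sum_congr rfl fun j _ => Finset.sum_congr rfl fun k _ => by ring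
  rw [h, Matrix.mulVec, dotProduct]
  simp only [boundaryMatrix, Matrix.of_apply, sub_mul, ite_mul, zero_mul, Finset.sum_sub_distrib,
    Finset.sum_ite_eq, Finset.mem_univ, if_true, mul_sub, Finset.mul_sum]
  congr 1
  exact Finset.sum_congr rfl fun j _ => by ring

/-- An eigensequence is $f=(\lambda-T)^{-1}v$ with $v_i=\lambda f(i)$. Its interior equations hold
automatically, and its boundary equations say that $v$ is fixed by $M(\lambda)$. -/
lemma IsWalk.det_boundaryMatrix_eq_zero_iff (hP : IsWalk P c g d a) (hγ : 0 < γ) {lam : ℂ}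
    (hlam : phi g d a γ < ‖lam‖) : (hP.boundaryMatrix hγ lam).det = 0 ↔
      ∃ f ∈ growth γ, f ≠ 0 ∧ ∀ i, act P f i = lam * f i := by
  have hlam0 : lam ≠ 0 := norm_pos_iff.1 ((phi_pos hP.a_nonneg hP.a_left hγ).trans hlam)
  rw [← Matrix.exists_mulVec_eq_zero_iff]
  constructor
  · rintro ⟨v, hv, h⟩
    refine ⟨_, toSeq_mem_growth hγ (hP.solve hγ lam v), fun h0 => hv ?_, fun i => ?_⟩
    · ext i
      rw [← hP.solve_boundary hγ hlam v i, h0, Pi.zero_apply, Pi.zero_apply, mul_zero]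
    · rcases lt_or_ge i g with hi | hi
      · have h1 := congrFun h ⟨i, hi⟩
        rw [hP.boundaryMatrix_mulVec, Pi.zero_apply, mul_eq_zero, or_iff_right hlam0,
          sub_eq_zero] at h1
        rw [← h1]
        exact (hP.solve_boundary hγ hlam v ⟨i, hi⟩).symm
      · exact hP.solve_interior hγ hlam v hi
  · rintro ⟨f, hf, hne, heig⟩
    have h := hP.eq_solve hγ hlam (hP.mem_interiorSolutions.2 ⟨hf, fun i _ => heig i⟩)
    refine ⟨fun i => lam * f i, fun h0 => hne ?_, ?_⟩
    · rw [← h, h0, IsWalk.solve, initial]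
      simp
    · ext i
      rw [hP.boundaryMatrix_mulVec, h, heig, sub_self, mul_zero, Pi.zero_apply]

lemma differentiableAt_resolvent_apply {E : Type*} [NormedAddCommGroup E] [NormedSpace ℂ E]
    [CompleteSpace E] {A : E →L[ℂ] E} {lam : ℂ} (hlam : lam ∈ resolventSet ℂ A) (h : E)
    (ψ : E →L[ℂ] ℂ) : DifferentiableAt ℂ (fun lam => ψ (resolvent A lam h)) lam := by
  have h1 : DifferentiableAt ℂ (resolvent A) lam :=
    (spectrum.hasDerivAt_resolvent_const_left hlam).differentiableAt
  exact ψ.differentiableAt.comp lam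
    ((ContinuousLinearMap.apply ℂ E h).differentiableAt.comp lam h1)

/-- Each boundary row involves finitely many coordinates of the resolvent, which is holomorphic
where $\lambda-T$ is invertible. -/
lemma IsWalk.analyticOnNhd_det (hP : IsWalk P c g d a) (hγ : 0 < γ) :
    AnalyticOnNhd ℂ (fun lam => (hP.boundaryMatrix hγ lam).det)
      {lam : ℂ | phi g d a γ < ‖lam‖} := by
  refine DifferentiableOn.analyticOnNhd (fun lam hlam => ?_)
    (isOpen_lt continuous_const continuous_norm)
  refine DifferentiableAt.differentiableWithinAt ?_
  have hentry : ∀ i j, DifferentiableAt ℂ (fun lam => hP.boundaryMatrix hγ lam i j) lam := by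
    intro i j
    simp only [boundaryMatrix, Matrix.of_apply, hP.act_boundary _ i.2]
    refine DifferentiableAt.sub ?_ (differentiableAt_id.mul ?_)
    · split_ifs
      · exact differentiableAt_id
      · exact differentiableAt_const _
    · refine DifferentiableAt.fun_sum fun k _ => (DifferentiableAt.const_mul ?_ _)
      simp only [toSeq_apply, solve]
      refine DifferentiableAt.const_mul ?_ _
      exact differentiableAt_resolvent_apply (hP.mem_resolventSet hγ hlam) _
        (BoundedContinuousFunction.evalCLM ℂ k)
  simp only [Matrix.det_apply]
  refine DifferentiableAt.fun_sum fun σ _ => DifferentiableAt.const_smul ?_ _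
  exact DifferentiableAt.fun_finsetProd fun i _ => hentry _ _

end Finiteness

/-! ### Algebraicity of the boundary determinant -/

section Algebraicity

open scoped BoundedContinuousFunction

variable {P : ℕ → ℕ → ℝ} {c g d : ℕ} {a : ℤ → ℝ} {γ : ℝ}

/-- Polynomials in `λ` as functions on a set. -/
def polyFun (U : Set ℂ) : ℂ[X] →+* (U → ℂ) := RingHom.pi fun lam => evalRingHom (lam : ℂ)

lemma polyFun_apply (U : Set ℂ) (p : ℂ[X]) (lam : U) : polyFun U p lam = p.eval (lam : ℂ) := rfl

/-- Dividing $E_\lambda$ by the constant $a_d$ makes it monic over $\mathbb C[\lambda]$. Any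
pointwise choice of roots qualifies, since equality in the ring of all functions on $U$ is checked
pointwise; no continuity is required. -/
lemma integral_of_charPoly (hd : 1 ≤ d) (hr : a d ≠ 0) {U : Set ℂ} (z : U → ℂ)
    (hz : ∀ lam : U, (charPoly g d a (lam : ℂ)).eval (z lam) = 0) :
    (polyFun U).IsIntegralElem z := by
  have hr' : (algebraMap ℝ ℂ[X] (a d)) * C ((a d : ℂ)⁻¹) = 1 := by
    rw [Polynomial.algebraMap_apply, ← C_mul, Complex.coe_algebraMap,
      mul_inv_cancel₀ (Complex.ofReal_ne_zero.2 hr), C_1]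
  have hdeg := natDegree_charPoly (g := g) (a := a) hd hr (X : ℂ[X])
  refine ⟨charPoly g d a (X : ℂ[X]) * C (C ((a d : ℂ)⁻¹)), ?_, ?_⟩
  · refine monic_mul_C_of_leadingCoeff_mul_eq_one ?_
    rw [leadingCoeff, hdeg.1, hdeg.2, hr']
  · ext lam
    have h : ((Pi.evalRingHom (fun _ : U => ℂ) lam).comp (polyFun U)) =
        ((Polynomial.aeval (R := ℂ) (lam : ℂ)).restrictScalars ℝ : ℂ[X] →+* ℂ) := by
      ext x <;> simp [polyFun_apply]
    have h2 : (eval₂ (polyFun U) z (charPoly g d a (X : ℂ[X]))) lam = 0 := by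
      have := Polynomial.hom_eval₂ (charPoly g d a (X : ℂ[X])) (polyFun U)
        (Pi.evalRingHom (fun _ : U => ℂ) lam) z
      refine this.trans ?_
      rw [h, eval₂_eq_eval_map, charPoly_map]
      simpa using hz lam
    rw [eval₂_mul, Pi.mul_apply, h2, zero_mul, Pi.zero_apply]

lemma exists_enumeration {n : ℕ} (s : Multiset ℂ) (hs : s.card = n) :
    ∃ z : Fin n → ℂ, s = Finset.univ.val.map z := by
  obtain ⟨l, rfl⟩ : ∃ l : List ℂ, (l : Multiset ℂ) = s := Quot.exists_rep s
  obtain rfl : l.length = n := hs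
  refine ⟨l.get, ?_⟩
  rw [Fin.univ_val_map]
  exact congrArg _ (List.ofFn_get l).symm

/-- The determinant of the boundary matrix is integral over the polynomials in `λ`. -/
lemma IsWalk.exists_monic_relation (hP : IsWalk P c g d a) (hγ : 0 < γ) :
    ∃ p : ℂ[X][X], p.Monic ∧ ∀ lam ∈ {lam : ℂ | phi g d a γ < ‖lam‖},
      (p.map (evalRingHom lam)).eval (hP.boundaryMatrix hγ lam).det = 0 := by
  set U := {lam : ℂ | phi g d a γ < ‖lam‖}
  let _ : Algebra ℂ[X] (U → ℂ) := (polyFun U).toAlgebra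
  let A := integralClosure ℂ[X] (U → ℂ)
  have hmemA : ∀ f : U → ℂ, (polyFun U).IsIntegralElem f → f ∈ A := fun f hf => hf
  have hpoly : ∀ p : ℂ[X], (fun lam : U => p.eval (lam : ℂ)) ∈ A := fun p =>
    A.algebraMap_mem p
  have hconst : ∀ x : ℂ, (fun _ : U => x) ∈ A := fun x => by simpa using hpoly (C x)
  have hex : ∀ lam : U, ∃ z : Fin g → ℂ, smallMultiset g d a γ (lam : ℂ) =
      Finset.univ.val.map z := fun lam =>
    exists_enumeration _ ((card_smallMultiset _).trans (hP.numSmall_eq hγ lam.2))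
  choose z hz using hex
  have hzA : ∀ i : Fin g, (fun lam : U => z lam i) ∈ A := fun i => by
    refine hmemA _ (integral_of_charPoly (g := g) (a := a) hP.d_pos hP.a_right.ne' _ fun lam => ?_)
    have h1 : z lam i ∈ smallMultiset g d a γ (lam : ℂ) := by
      rw [hz lam]
      exact Multiset.mem_map_of_mem _ (Finset.mem_univ_val i)
    exact isRoot_of_mem_roots (Multiset.mem_of_mem_filter h1)
  -- The coefficients of the small-root polynomial are polynomials in the chosen roots, so as
  -- functions of $\lambda$ they are integral.
  let Q : A[X] := ∏ i : Fin g, (X - C (⟨_, hzA i⟩ : A))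
  have hQ : ∀ (lam : U) (n : ℕ), (Q.coeff n : U → ℂ) lam = (smallPoly g d a γ lam).coeff n := by
    intro lam n
    have h1 : Q.map ((Pi.evalRingHom (fun _ : U => ℂ) lam).comp (A.val : A →+* (U → ℂ))) =
        smallPoly g d a γ lam := by
      rw [Polynomial.map_prod, smallPoly, hz lam, Multiset.map_map]
      refine Finset.prod_congr rfl fun i _ => ?_
      simp
    rw [← h1, coeff_map]
    rfl
  -- It is $\lambda$ times the solution that is integral: its first $g$ values are constants, while
  -- those of the solution carry $1/\lambda$. The small-root recurrence, monic of order $g$,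
  -- propagates integrality. This explains the factor $\lambda$ in the boundary matrix.
  have hS : ∀ (j : Fin g) (n : ℕ),
      (fun lam : U => (lam : ℂ) * toSeq γ (hP.solve hγ lam (Pi.single j 1)) n) ∈ A := by
    intro j n
    induction n using Nat.strong_induction_on with
    | _ n ih =>
      rcases lt_or_ge n g with hn | hn
      · have : (fun lam : U => (lam : ℂ) * toSeq γ (hP.solve hγ lam (Pi.single j 1)) n) =
            fun _ => (Pi.single j 1 : Fin g → ℂ) ⟨n, hn⟩ := by
          ext lam
          exact hP.solve_boundary hγ lam.2 _ ⟨n, hn⟩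
        rw [this]
        exact hconst _
      · have : (fun lam : U => (lam : ℂ) * toSeq γ (hP.solve hγ lam (Pi.single j 1)) n) =
            -∑ i ∈ Finset.range g, (Q.coeff i : U → ℂ) * (fun lam : U =>
              (lam : ℂ) * toSeq γ (hP.solve hγ lam (Pi.single j 1)) (n - g + i)) := by
          ext lam
          have h1 := congrFun (hP.aeval_smallPoly hγ lam.2
            (hP.solve_mem hγ lam.2 (Pi.single j 1))) (n - g)
          have h2 := (monic_smallPoly (g := g) (d := d) (a := a) (γ := γ) (lam : ℂ)).coeff_natDegree
          rw [natDegree_smallPoly, hP.numSmall_eq hγ lam.2] at h2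
          rw [aeval_shift_apply, natDegree_smallPoly, hP.numSmall_eq hγ lam.2,
            Finset.sum_range_succ, h2, one_mul, Nat.sub_add_cancel hn, Pi.zero_apply] at h1
          simp only [Pi.neg_apply, Finset.sum_apply, Pi.mul_apply, hQ]
          rw [eq_neg_of_add_eq_zero_right h1, mul_neg, Finset.mul_sum]
          congr 1
          exact Finset.sum_congr rfl fun i _ => by ring
        rw [this]
        refine A.neg_mem (A.sum_mem fun i hi => A.mul_mem (Q.coeff i).2 (ih _ ?_))
        rw [Finset.mem_range] at hi
        omega
  have hM : ∀ i j : Fin g, (fun lam : U => hP.boundaryMatrix hγ (lam : ℂ) i j) ∈ A := by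
    intro i j
    have : (fun lam : U => hP.boundaryMatrix hγ (lam : ℂ) i j) =
        (fun lam : U => (if i = j then (X : ℂ[X]) else 0).eval (lam : ℂ)) -
          ∑ k ∈ Finset.range (c + 1), (fun _ : U => (P i k : ℂ)) * (fun lam : U =>
            (lam : ℂ) * toSeq γ (hP.solve hγ lam (Pi.single j 1)) k) := by
      ext lam
      simp only [boundaryMatrix, Matrix.of_apply, hP.act_boundary _ i.2, Pi.sub_apply,
        Finset.sum_apply, Pi.mul_apply, Finset.mul_sum]
      congr 1
      · split_ifs <;> simp
      · exact Finset.sum_congr rfl fun k _ => by ring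
    rw [this]
    exact A.sub_mem (hpoly _) (A.sum_mem fun k _ => A.mul_mem (hconst _) (hS j k))
  let N : Matrix (Fin g) (Fin g) A := Matrix.of fun i j => ⟨_, hM i j⟩
  have hN : ∀ lam : U, (N.det : U → ℂ) lam = (hP.boundaryMatrix hγ (lam : ℂ)).det := by
    intro lam
    have := RingHom.map_det
      ((Pi.evalRingHom (fun _ : U => ℂ) lam).comp (A.val : A →+* (U → ℂ))) N
    refine this.trans (congrArg Matrix.det ?_)
    ext i j
    rfl
  obtain ⟨p, hp, hp0⟩ : IsIntegral ℂ[X] (N.det : U → ℂ) := N.det.2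
  refine ⟨p, hp, fun lam hl => ?_⟩
  have h1 := congrFun hp0 ⟨lam, hl⟩
  have h2 := Polynomial.hom_eval₂ p (polyFun U)
    (Pi.evalRingHom (fun _ : U => ℂ) ⟨lam, hl⟩) (N.det : U → ℂ)
  rw [eval_map]
  have h3 : (Pi.evalRingHom (fun _ : U => ℂ) ⟨lam, hl⟩).comp (polyFun U) = evalRingHom lam := rfl
  rw [h3] at h2
  have h4 := hN ⟨lam, hl⟩
  rw [← h4]
  exact h2.symm.trans h1

/-- There are finitely many eigenvalues of modulus `> φ(γ)` on sequences `O(γ^n)`. -/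
lemma IsWalk.finite_eigenvalues (hP : IsWalk P c g d a) (hirr : IsIrreducible P)
    (haper : IsAperiodic P) (hγ : 1 < γ) (hδ : phi g d a γ < 1) :
    {lam : ℂ | phi g d a γ < ‖lam‖ ∧
      ∃ f ∈ growth γ, f ≠ 0 ∧ ∀ i, act P f i = lam * f i}.Finite := by
  have hγ0 : 0 < γ := by linarith
  obtain ⟨p, hp, hrel⟩ := hP.exists_monic_relation hγ0
  -- Working on the whole exterior domain rather than the annulus makes a point such as $2$
  -- available: the only eigenvalue of modulus at least $1$ is $1$, so the determinant is not
  -- identically zero.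
  have h2 : (2 : ℂ) ∈ {lam : ℂ | phi g d a γ < ‖lam‖} := by
    rw [Set.mem_ofPred_eq, Complex.norm_two]; linarith
  have h20 : (hP.boundaryMatrix hγ0 2).det ≠ 0 := by
    rw [Ne, hP.det_boundaryMatrix_eq_zero_iff hγ0 h2]
    rintro ⟨f, hf, hne, heig⟩
    have := (hP.peripheral hirr haper hγ hδ (by rw [Complex.norm_two]; norm_num) hf heig hne).1
    norm_num at this
  refine (finite_zeros_of_monic_relation
    (isPreconnected_lt_norm (phi_pos hP.a_nonneg hP.a_left hγ0))
    (hP.analyticOnNhd_det hγ0) h2 h20 _ p hp rfl hrel).subset ?_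
  rintro lam ⟨hl, h⟩
  exact ⟨hl, (hP.det_boundaryMatrix_eq_zero_iff hγ0 hl).2 h⟩

/-! ### The candidates are the eigenvalues -/

/-- The pattern is the list of multiplicities of the small roots, sorted to be nondecreasing. The
coefficients in condition (ii) solve the boundary system at these roots, so every minor vanishes
there; the roots being distinct, so does the reduced minor. -/
lemma IsWalk.exists_pattern (hP : IsWalk P c g d a) (hγ : 0 < γ) {lam : ℂ}
    (hlam : lam ∈ annulus g d a γ) (hb : BoundaryCondition P g d a γ lam) :
    ∃ μ ∈ patterns g, lam ∈ annulusZeros P c g d a γ μ := by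
  set R := smallRoots g d a γ lam
  set s := R.card
  have hsum : ∑ z ∈ R, mult g d a lam z = g := hP.numSmall_eq hγ hlam.1
  let e₀ : Fin s ≃ R := R.equivFin.symm
  let e : Fin s ≃ R := (Tuple.sort fun i => mult g d a lam (e₀ i)).trans e₀
  let m : Fin s → ℕ := fun i => mult g d a lam (e i)
  have hmono : Monotone m := Tuple.monotone_sort fun i => mult g d a lam (e₀ i)
  have hm : ∑ i, m i = g := by
    rw [← hsum, ← Finset.sum_coe_sort R]
    exact e.sum_comp fun z : R => mult g d a lam z
  have hpos : ∀ i, 1 ≤ m i := fun i => by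
    have h1 := (mem_smallRoots.1 (e i).2).1
    exact (rootMultiplicity_pos (hP.charPoly_ne_zero lam)).2 (isRoot_of_mem_roots h1)
  refine ⟨⟨s, m⟩, ⟨?_, hpos, hmono, hm⟩, hlam, fun r => ?_⟩
  · by_contra! h
    have hR : R = ∅ := Finset.card_eq_zero.1 (Nat.lt_one_iff.1 h)
    rw [hR, Finset.sum_empty] at hsum
    have := hP.g_pos
    omega
  · obtain ⟨α, ⟨z, hz, k, hk, hne⟩, hbd⟩ := hb
    let ζ : Fin s → ℂ := fun i => e i
    have hζ : Function.Injective ζ := Subtype.val_injective.comp e.injective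
    refine eval_eliminate_eq_zero hP.d_pos hP.a_right.ne' lam s ζ _ (fun i => ?_) ?_
    · exact isRoot_of_mem_roots (mem_smallRoots.1 (e i).2).1
    · refine evalAt_exactQuot lam ζ ?_ (evalAt_diffProd_ne_zero lam ζ hζ m)
      refine evalAt_minor_eq_zero lam ζ m r (fun q => α (ζ q.1) (q.2 + 1)) (fun h0 => hne ?_) ?_
      · rw [Finset.mem_Icc] at hk
        have hlt : k - 1 < m (e.symm ⟨z, hz⟩) := by
          simp only [m, Equiv.apply_symm_apply]
          omega
        have := congrFun h0 ⟨e.symm ⟨z, hz⟩, ⟨k - 1, hlt⟩⟩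
        simpa [ζ, Nat.sub_add_cancel hk.1] using this
      · intro b hb
        have h1 := hbd b hb
        rw [hP.act_boundary _ hb, eq_comm, ← sub_eq_zero] at h1
        rw [← h1, Fintype.sum_sigma]
        have h2 : ∀ F : ℂ → ℕ → ℂ,
            ∑ z ∈ smallRoots g d a γ lam, ∑ k ∈ Finset.Icc 1 (mult g d a lam z), F z k =
            ∑ i : Fin s, ∑ k : Fin (m i), F (ζ i) (k + 1) := by
          intro F
          rw [← Finset.sum_coe_sort R, ← e.sum_comp]
          exact Finset.sum_congr rfl fun i _ => sum_Icc_one_eq _ _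
        simp only [h2, boundaryCoeff, Finset.mul_sum]
        rw [Finset.sum_comm, ← Finset.sum_sub_distrib]
        refine Finset.sum_congr rfl fun i _ => ?_
        rw [Finset.sum_comm, ← Finset.sum_sub_distrib]
        refine Finset.sum_congr rfl fun k _ => ?_
        rw [sub_mul, Finset.sum_mul, Complex.coe_algebraMap]
        congr 1
        · exact Finset.sum_congr rfl fun j _ => by ring
        · ring

/-- Condition (ii) alone already characterizes eigenvalues, so the elimination step only has to be
shown not to lose any of them. -/
lemma IsWalk.candidates_eq (hP : IsWalk P c g d a) (hγ : 0 < γ) :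
    candidates P c g d a γ g = {lam ∈ annulus g d a γ |
      ∃ f ∈ growth γ, f ≠ 0 ∧ ∀ i, act P f i = lam * f i} := by
  ext lam
  constructor
  · rintro ⟨h1, h2⟩
    simp only [Set.mem_iUnion] at h1
    obtain ⟨μ, -, h1⟩ := h1
    exact ⟨h1.1, (hP.boundaryCondition_iff hγ h1.1.1).1 h2⟩
  · rintro ⟨h1, h2⟩
    have hb := (hP.boundaryCondition_iff hγ h1.1).2 h2
    obtain ⟨μ, hμ, h3⟩ := hP.exists_pattern hγ h1 hb
    refine ⟨?_, hb⟩
    simp only [Set.mem_iUnion]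
    exact ⟨μ, hμ, h3⟩

end Algebraicity

/-! ### Means of sequences along an ultrafilter -/

section Mean

/-- `l` is the limit of the Cesàro means of `x` along a fixed nonprincipal ultrafilter. -/
def HasMean (x : ℕ → ℝ) (l : ℝ) : Prop :=
  Filter.Tendsto (fun n : ℕ => (∑ k ∈ Finset.range (n + 1), x k) / (n + 1))
    (Filter.hyperfilter ℕ : Filter ℕ) (nhds l)

lemma average_mem_Icc {x : ℕ → ℝ} {l u : ℝ} (h : ∀ k, x k ∈ Set.Icc l u) (n : ℕ) :
    (∑ k ∈ Finset.range (n + 1), x k) / (n + 1) ∈ Set.Icc l u := by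
  have hn : (0 : ℝ) < n + 1 := by positivity
  constructor
  · rw [le_div_iff₀ hn]
    have := Finset.card_nsmul_le_sum (Finset.range (n + 1)) x l fun k _ => (h k).1
    simpa [mul_comm] using this
  · rw [div_le_iff₀ hn]
    have := Finset.sum_le_card_nsmul (Finset.range (n + 1)) x u fun k _ => (h k).2
    simpa [mul_comm] using this

/-- Along an ultrafilter every bounded sequence has a mean, so all coordinates converge at once
without a diagonal extraction. -/
lemma exists_hasMean {x : ℕ → ℝ} {l u : ℝ} (h : ∀ k, x k ∈ Set.Icc l u) : ∃ m, HasMean x m := by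
  obtain ⟨m, -, hm⟩ := (isCompact_Icc (a := l) (b := u)).ultrafilter_le_nhds'
    ((Filter.hyperfilter ℕ).map fun n : ℕ => (∑ k ∈ Finset.range (n + 1), x k) / ((n : ℝ) + 1))
    (Ultrafilter.mem_map.2 (Filter.Eventually.of_forall fun n => average_mem_Icc h n))
  exact ⟨m, hm⟩

lemma HasMean.mem_Icc {x : ℕ → ℝ} {l u m : ℝ} (hx : HasMean x m) (h : ∀ k, x k ∈ Set.Icc l u) :
    m ∈ Set.Icc l u :=
  isClosed_Icc.mem_of_tendsto hx (Filter.Eventually.of_forall fun n => average_mem_Icc h n)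

lemma HasMean.unique {x : ℕ → ℝ} {l m : ℝ} (h₁ : HasMean x l) (h₂ : HasMean x m) : l = m :=
  tendsto_nhds_unique h₁ h₂

lemma HasMean.sum {ι : Type*} (s : Finset ι) {x : ι → ℕ → ℝ} {l : ι → ℝ} (w : ι → ℝ)
    (h : ∀ i ∈ s, HasMean (x i) (l i)) :
    HasMean (fun k => ∑ i ∈ s, w i * x i k) (∑ i ∈ s, w i * l i) := by
  have := tendsto_finsetSum s fun i hi => Filter.Tendsto.const_mul (w i) (h i hi)
  refine this.congr fun n => ?_
  rw [Finset.sum_comm, Finset.sum_div]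
  exact Finset.sum_congr rfl fun i _ => by rw [← Finset.mul_sum, mul_div_assoc]

/-- The two averages differ by $(x_{n+1}-x_0)/(n+1)$, which tends to $0$ because the ultrafilter is
nonprincipal. -/
lemma HasMean.shift {x : ℕ → ℝ} {l u m : ℝ} (hx : HasMean x m) (h : ∀ k, x k ∈ Set.Icc l u) :
    HasMean (fun k => x (k + 1)) m := by
  have h0 : Filter.Tendsto (fun n : ℕ => (x (n + 1) - x 0) / ((n : ℝ) + 1))
      (Filter.hyperfilter ℕ : Filter ℕ) (nhds 0) := by
    refine Filter.Tendsto.mono_left ?_ Nat.hyperfilter_le_atTop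
    have h1 : Filter.Tendsto (fun n : ℕ => (u - l) / ((n : ℝ) + 1)) Filter.atTop (nhds 0) :=
      Filter.Tendsto.const_div_atTop
        (Filter.tendsto_atTop_add_const_right _ 1 tendsto_natCast_atTop_atTop) _
    refine squeeze_zero_norm (fun n => ?_) h1
    have hn : (0 : ℝ) < n + 1 := by positivity
    rw [norm_div, Real.norm_of_nonneg hn.le]
    gcongr
    rw [Real.norm_eq_abs, abs_le]
    constructor <;> linarith [(h 0).1, (h 0).2, (h (n + 1)).1, (h (n + 1)).2]
  have h1 := hx.add h0
  rw [add_zero] at h1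
  refine h1.congr fun n => ?_
  rw [← add_div]
  congr 1
  have := Finset.sum_range_succ' x (n + 1)
  rw [Finset.sum_range_succ] at this
  linarith

end Mean

/-! ### Duality between kernels and measures -/

section Duality

variable {γ : ℝ} {K : ℕ → ℕ → ℝ} {B : ℝ} {ν : ℕ → ℝ}

lemma WeightBounded.summable_prod (hK : WeightBounded γ K B) (hγ : 0 ≤ γ) (hν : ∀ i, 0 ≤ ν i)
    (hs : Summable fun i => ν i * γ ^ i) :
    Summable fun p : ℕ × ℕ => ν p.1 * (K p.1 p.2 * γ ^ p.2) := by
  have hnn : ∀ i j, 0 ≤ ν i * (K i j * γ ^ j) := fun i j =>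
    mul_nonneg (hν i) (mul_nonneg (hK.nonneg i j) (pow_nonneg hγ j))
  have hrow : Summable fun i => ∑' j, ν i * (K i j * γ ^ j) := by
    refine Summable.of_nonneg_of_le (fun i => tsum_nonneg fun j => hnn i j) (fun i => ?_)
      (hs.mul_left B)
    have h := mul_le_mul_of_nonneg_left (hK.tsum_le i) (hν i)
    rw [← tsum_mul_left] at h
    linarith
  exact (summable_prod_of_nonneg (f := fun p : ℕ × ℕ => ν p.1 * (K p.1 p.2 * γ ^ p.2))
    fun p => hnn p.1 p.2).2 ⟨fun i => (hK.summable i).mul_left (ν i), hrow⟩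

/-- Fubini for $\nu(Kf)=(\nu K)f$; the weight $\gamma^j$ dominates $f$ and gives absolute
convergence. -/
lemma WeightBounded.tsum_mul_act (hK : WeightBounded γ K B) (hγ : 0 ≤ γ) (hν : ∀ i, 0 ≤ ν i)
    (hs : Summable fun i => ν i * γ ^ i) {f : ℕ → ℂ} (hf : f ∈ growth γ) :
    ∑' i, (ν i : ℂ) * act K f i = ∑' j, ((∑' i, ν i * K i j : ℝ) : ℂ) * f j := by
  obtain ⟨C, hC⟩ := hf
  have hsum : Summable fun p : ℕ × ℕ => (ν p.1 : ℂ) * ((K p.1 p.2 : ℂ) * f p.2) := by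
    refine Summable.of_norm_bounded ((hK.summable_prod hγ hν hs).mul_left C) fun p => ?_
    rw [norm_mul, norm_mul, Complex.norm_real, Complex.norm_real, Real.norm_of_nonneg (hν _),
      Real.norm_of_nonneg (hK.nonneg _ _)]
    calc ν p.1 * (K p.1 p.2 * ‖f p.2‖) ≤ ν p.1 * (K p.1 p.2 * (C * γ ^ p.2)) :=
          mul_le_mul_of_nonneg_left (mul_le_mul_of_nonneg_left (hC _) (hK.nonneg _ _)) (hν _)
      _ = C * (ν p.1 * (K p.1 p.2 * γ ^ p.2)) := by ring
  have h := Summable.tsum_comm (f := fun i j => (ν i : ℂ) * ((K i j : ℂ) * f j)) hsum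
  simp only [tsum_mul_left] at h
  refine h.symm.trans (tsum_congr fun j => ?_)
  rw [Complex.ofReal_tsum, ← tsum_mul_right]
  exact tsum_congr fun i => by push_cast; ring

end Duality

/-! ### Existence of an invariant probability measure -/

section Invariant

variable {P : ℕ → ℕ → ℝ} {c g d : ℕ} {a : ℤ → ℝ} {γ : ℝ}

/-- Downward jumps have size at most $g$, so a state is entered from finitely many others.
Invariance is thus a finite identity in each coordinate and survives pointwise limits. -/
lemma IsWalk.column_eq_zero (hP : IsWalk P c g d a) {i j : ℕ} (h : i ∉ Finset.range (j + g + 1)) :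
    P i j = 0 := by
  rw [Finset.mem_range] at h
  rw [hP.interior i j (by omega), if_neg (by omega)]

/-- The law of the walk started at `0`. -/
def law (P : ℕ → ℕ → ℝ) : ℕ → ℕ → ℝ
  | 0, j => if j = 0 then 1 else 0
  | n + 1, j => ∑' i, law P n i * P i j

lemma law_nonneg (hP : ∀ i j, 0 ≤ P i j) (n j : ℕ) : 0 ≤ law P n j := by
  induction n generalizing j with
  | zero => rw [law]; split_ifs <;> norm_num
  | succ n ih => exact tsum_nonneg fun i => mul_nonneg (ih i) (hP i j)

lemma IsWalk.law_succ (hP : IsWalk P c g d a) (n j : ℕ) :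
    law P (n + 1) j = ∑ i ∈ Finset.range (j + g + 1), P i j * law P n i := by
  rw [law, tsum_eq_sum fun i hi => by rw [hP.column_eq_zero hi, mul_zero]]
  exact Finset.sum_congr rfl fun i _ => mul_comm _ _

lemma IsWalk.weightBounded_one (hP : IsMarkov P) : WeightBounded 1 P 1 where
  nonneg := hP.1
  summable i := by simpa using (hP.2 i).summable
  tsum_le i := by simpa using (hP.2 i).tsum_eq.le

/-- The moments satisfy $M_{n+1}\le\varphi(\gamma)M_n+\gamma^c$ with $M_0=1$. The bound is the fixed
point of this affine map plus the initial value, and the map preserves it. -/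
lemma IsWalk.law_bounds (hP : IsWalk P c g d a) (hγ : 1 < γ) (hδ : phi g d a γ < 1) (n : ℕ) :
    HasSum (law P n) 1 ∧ (Summable fun j => law P n j * γ ^ j) ∧
      ∑' j, law P n j * γ ^ j ≤ 1 + γ ^ c / (1 - phi g d a γ) := by
  have hγ0 : 0 < γ := by linarith
  have hδ' : 0 < 1 - phi g d a γ := by linarith
  have hγc : 0 < γ ^ c := by positivity
  induction n with
  | zero =>
    have h0 : (fun j => law P 0 j) = fun j => if j = 0 then (1 : ℝ) else 0 := rfl
    have h1 : (fun j => law P 0 j * γ ^ j) = fun j => if j = 0 then (1 : ℝ) else 0 := by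
      ext j
      rw [law]
      split_ifs with h
      · simp [h]
      · simp
    have h2 := hasSum_ite_eq (0 : ℕ) (1 : ℝ)
    refine ⟨h2, h1 ▸ h2.summable, ?_⟩
    rw [h1, h2.tsum_eq]
    have : 0 < γ ^ c / (1 - phi g d a γ) := by positivity
    linarith
  | succ n ih =>
    obtain ⟨ih1, ih2, ih3⟩ := ih
    have hnn := law_nonneg hP.markov.1 n
    obtain ⟨hrow, hK⟩ := hP.weightBounded hγ
    have hs1 := (IsWalk.weightBounded_one hP.markov).summable_prod zero_le_one hnn
      (by simpa using ih1.summable)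
    have hs2 := hK.summable_prod hγ0.le hnn ih2
    simp only [one_pow, mul_one] at hs1
    have e2 : ∀ j, ∑' i, law P n i * (P i j * γ ^ j) = law P (n + 1) j * γ ^ j := fun j => by
      rw [law, ← tsum_mul_right]
      exact tsum_congr fun i => (mul_assoc _ _ _).symm
    have hsum1 : Summable (law P (n + 1)) := hs1.prod_symm.prod
    have hsum2 : Summable fun j => law P (n + 1) j * γ ^ j := by
      simpa only [Prod.swap, e2] using hs2.prod_symm.prod
    have ht1 : ∑' j, law P (n + 1) j = 1 := by
      have h := Summable.tsum_comm (f := fun i j => law P n i * P i j) hs1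
      simp only [tsum_mul_left, (hP.markov.2 _).tsum_eq, mul_one, ih1.tsum_eq] at h
      exact h
    refine ⟨ht1 ▸ hsum1.hasSum, hsum2, ?_⟩
    have h := Summable.tsum_comm (f := fun i j => law P n i * (P i j * γ ^ j)) hs2
    simp only [e2, tsum_mul_left] at h
    rw [h]
    have h3 : ∑' i, law P n i * ∑' j, P i j * γ ^ j ≤
        ∑' i, (phi g d a γ * (law P n i * γ ^ i) + law P n i * γ ^ c) := by
      refine Summable.tsum_le_tsum (fun i => ?_) ?_
        ((ih2.mul_left _).add (ih1.summable.mul_right _))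
      · have := mul_le_mul_of_nonneg_left (hrow i) (hnn i)
        linarith
      · simpa only [tsum_mul_left] using hs2.prod
    refine h3.trans ?_
    rw [(ih2.mul_left _).tsum_add (ih1.summable.mul_right _), tsum_mul_left, tsum_mul_right,
      ih1.tsum_eq, one_mul]
    have hφ := phi_pos hP.a_nonneg hP.a_left hγ0
    have h4 := mul_le_mul_of_nonneg_left ih3 hφ.le
    have h5 : γ ^ c = (1 - phi g d a γ) * (γ ^ c / (1 - phi g d a γ)) := by field_simp
    nlinarith

/-- Krylov–Bogoliubov argument: the mean of the laws of the walk from $0$ is invariant, and the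
uniform moment bound prevents loss of mass and passes to the limit. -/
lemma IsWalk.exists_invariant (hP : IsWalk P c g d a) (hγ : 1 < γ) (hδ : phi g d a γ < 1) :
    ∃ π, IsInvariantProb P π ∧ Summable fun n => π n * γ ^ n := by
  have hγ0 : 0 < γ := by linarith
  set B := 1 + γ ^ c / (1 - phi g d a γ)
  have hB : 0 ≤ B := by
    have : 0 < 1 - phi g d a γ := by linarith
    positivity
  have hq := hP.law_bounds hγ hδ
  have hnn := law_nonneg hP.markov.1
  have hIcc : ∀ j k, law P k j ∈ Set.Icc (0 : ℝ) 1 := fun j k =>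
    ⟨hnn k j, le_hasSum (hq k).1 j fun i _ => hnn k i⟩
  have hex : ∀ j, ∃ m, HasMean (fun k => law P k j) m := fun j => exists_hasMean (hIcc j)
  choose π hπ using hex
  have hπ0 : ∀ j, 0 ≤ π j := fun j => ((hπ j).mem_Icc (hIcc j)).1
  -- Tightness by Markov's inequality: the mass outside $\{0,\dots,N-1\}$ is at most $B\gamma^{-N}$,
  -- uniformly in time.
  have hmass : ∀ N, ∑ j ∈ Finset.range N, π j ∈ Set.Icc (1 - B * (γ ^ N)⁻¹) 1 := by
    intro N
    have h := HasMean.sum (Finset.range N) (fun _ => 1) fun j _ => hπ j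
    simp only [one_mul] at h
    refine h.mem_Icc fun k => ⟨?_, sum_le_hasSum _ (fun j _ => hnn k j) (hq k).1⟩
    have h1 : HasSum (fun j => if j ∈ Finset.range N then law P k j else 0)
        (∑ j ∈ Finset.range N, law P k j) := by
      have : HasSum (fun j => if j ∈ Finset.range N then law P k j else 0)
          (∑ j ∈ Finset.range N, if j ∈ Finset.range N then law P k j else 0) :=
        hasSum_sum_of_ne_finset_zero fun j hj => if_neg hj
      rwa [Finset.sum_congr rfl fun j hj => if_pos hj] at this
    have h2 := h1.add ((hq k).2.1.hasSum.mul_right (γ ^ N)⁻¹)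
    have hle : ∀ j, law P k j ≤ (if j ∈ Finset.range N then law P k j else 0) +
        law P k j * γ ^ j * (γ ^ N)⁻¹ := by
      intro j
      by_cases hj : j ∈ Finset.range N
      · have : 0 ≤ law P k j * γ ^ j * (γ ^ N)⁻¹ :=
          mul_nonneg (mul_nonneg (hnn k j) (by positivity)) (by positivity)
        rw [if_pos hj]
        linarith
      · rw [if_neg hj, zero_add, mul_assoc]
        refine le_mul_of_one_le_right (hnn k j) ?_
        rw [← div_eq_mul_inv, one_le_div (by positivity)]
        exact pow_le_pow_right₀ hγ.le (by simpa using hj)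
    have h3 := hasSum_le hle (hq k).1 h2
    have h4 : (∑' j, law P k j * γ ^ j) * (γ ^ N)⁻¹ ≤ B * (γ ^ N)⁻¹ :=
      mul_le_mul_of_nonneg_right (hq k).2.2 (by positivity)
    linarith
  have hweight : ∀ N, ∑ j ∈ Finset.range N, π j * γ ^ j ≤ B := by
    intro N
    have h := HasMean.sum (Finset.range N) (fun j => γ ^ j) fun j _ => hπ j
    have h1 := (h.mem_Icc (l := 0) (u := B) fun k => ⟨?_, ?_⟩).2
    · simpa only [mul_comm] using h1
    · exact Finset.sum_nonneg fun j _ => mul_nonneg (by positivity) (hnn k j)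
    · refine le_trans ?_ (hq k).2.2
      simp only [mul_comm (γ ^ _)]
      exact (hq k).2.1.sum_le_tsum _ fun j _ => mul_nonneg (hnn k j) (by positivity)
  have hinv : ∀ j, ∑ i ∈ Finset.range (j + g + 1), P i j * π i = π j := by
    intro j
    have h := HasMean.sum (Finset.range (j + g + 1)) (fun i => P i j) fun i _ => hπ i
    simp only [← hP.law_succ] at h
    exact h.unique ((hπ j).shift (hIcc j))
  refine ⟨π, ⟨hπ0, ?_, fun j => ?_⟩, ?_⟩
  · rw [hasSum_iff_tendsto_nat_of_nonneg hπ0]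
    have hlim : Filter.Tendsto (fun N : ℕ => 1 - B * (γ ^ N)⁻¹) Filter.atTop (nhds 1) := by
      have := (tendsto_inv_atTop_zero.comp (tendsto_pow_atTop_atTop_of_one_lt hγ)).const_mul B
      simpa using this.const_sub 1
    exact tendsto_of_tendsto_of_tendsto_of_le_of_le hlim tendsto_const_nhds
      (fun N => (hmass N).1) fun N => (hmass N).2
  · rw [← hinv j]
    simp only [mul_comm (P _ j)]
    exact hasSum_sum_of_ne_finset_zero fun i hi => by rw [hP.column_eq_zero hi, mul_zero]
  · exact summable_of_sum_range_le (fun j => mul_nonneg (hπ0 j) (by positivity)) hweight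

end Invariant

/-! ### Finite-rank perturbations and powers -/

section Operators

/-- On the finite-dimensional space `Y`, injectivity of $1-R$ gives surjectivity. Solving $w-Rw=Ry$
there, $x=y+w$ works. -/
lemma surjective_one_sub_of_finiteDimensional_range {𝕜 E : Type*} [Field 𝕜] [AddCommGroup E]
    [Module 𝕜 E] (R : E →ₗ[𝕜] E) (Y : Submodule 𝕜 E) [FiniteDimensional 𝕜 Y]
    (hR : ∀ x, R x ∈ Y) (hinj : ∀ x, R x = x → x = 0) (y : E) : ∃ x, x - R x = y := by
  let F : Y →ₗ[𝕜] Y := LinearMap.id - (R.comp Y.subtype).codRestrict Y fun x => hR x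
  have hF : Function.Injective F := by
    rw [injective_iff_map_eq_zero]
    intro w hw
    have h1 : (w : E) - R w = 0 := congrArg Subtype.val hw
    exact Subtype.ext (hinj w (sub_eq_zero.1 h1).symm)
  obtain ⟨w, hw⟩ := LinearMap.injective_iff_surjective.1 hF ⟨R y, hR y⟩
  have h1 : (w : E) - R w = R y := congrArg Subtype.val hw
  exact ⟨y + w, by rw [map_add, ← h1]; abel⟩

/-- A finite-rank perturbation of an operator has only eigenvalues as additional spectrum. -/
lemma exists_eigenvector_of_mem_spectrum {E : Type*} [NormedAddCommGroup E] [NormedSpace ℂ E]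
    [CompleteSpace E] {T N : E →L[ℂ] E} {lam : ℂ} (hT : lam ∈ resolventSet ℂ T)
    (Y : Submodule ℂ E) [FiniteDimensional ℂ Y] (hY : ∀ x, N x - T x ∈ Y)
    (hN : lam ∈ spectrum ℂ N) : ∃ x, x ≠ 0 ∧ N x = lam • x := by
  by_contra! hcon
  have hl : ∀ x, lam • resolvent T lam x - T (resolvent T lam x) = x := fun x => by
    have h : (algebraMap ℂ (E →L[ℂ] E) lam - T) * resolvent T lam = 1 :=
      Ring.mul_inverse_cancel _ hT
    simpa [Algebra.algebraMap_eq_smul_one] using congrArg (fun A => A x) h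
  refine hN ?_
  rw [spectrum.mem_resolventSet_iff, ContinuousLinearMap.isUnit_iff_bijective]
  have happ : ∀ x, (algebraMap ℂ (E →L[ℂ] E) lam - N) x = lam • x - N x := fun x => by
    simp [Algebra.algebraMap_eq_smul_one]
  constructor
  · rw [injective_iff_map_eq_zero]
    intro x hx
    by_contra hx0
    rw [happ, sub_eq_zero] at hx
    exact hcon x hx0 hx.symm
  · intro y
    -- The factorization is $\lambda-N=(\lambda-T)(1-R)$ with $R=(\lambda-T)^{-1}(N-T)$, so a fixed
    -- vector of $R$ would be an eigenvector of $N$.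
    let R : E →ₗ[ℂ] E := (resolvent T lam * (N - T) : E →L[ℂ] E)
    have hRx : ∀ x, R x = resolvent T lam (N x - T x) := fun x => rfl
    obtain ⟨x, hx⟩ := surjective_one_sub_of_finiteDimensional_range R
      (Y.map (resolvent T lam).toLinearMap)
      (fun x => ⟨N x - T x, hY x, rfl⟩) (fun x hx => by
        by_contra hx0
        refine hcon x hx0 ?_
        have h1 := hl (N x - T x)
        rw [← hRx, hx] at h1
        rw [sub_left_injective.eq_iff] at h1
        exact h1.symm) (resolvent T lam y)
    refine ⟨x, ?_⟩
    have h1 := hl y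
    rw [← hx, hRx, map_sub T, smul_sub, sub_sub_sub_comm, hl] at h1
    rw [happ, ← h1]
    abel

lemma sub_pow_eq {A : Type*} [Ring A] {p q : A} (h1 : p * q = q) (h2 : q * p = q)
    (h3 : q * q = q) (n : ℕ) : (p - q) ^ (n + 1) = p ^ (n + 1) - q := by
  have hpow : ∀ n : ℕ, p ^ n * q = q := fun n => by
    induction n with
    | zero => simp
    | succ n ih => rw [pow_succ, mul_assoc, h1, ih]
  induction n with
  | zero => simp
  | succ n ih => rw [pow_succ, ih, sub_mul, mul_sub, mul_sub, hpow, h2, h3, ← pow_succ]; abel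

/-- Gelfand's formula; compactness of the spectrum turns the pointwise bound into a strict bound on
the spectral radius. -/
lemma eventually_norm_pow_le {A : Type*} [NormedRing A] [NormedAlgebra ℂ A] [CompleteSpace A]
    [Nontrivial A] {N : A} {ρ : ℝ} (hρ : 0 < ρ) (h : ∀ z ∈ spectrum ℂ N, ‖z‖ < ρ) :
    ∀ᶠ n : ℕ in Filter.atTop, ‖N ^ n‖ ≤ ρ ^ n := by
  lift ρ to NNReal using hρ.le
  have h1 : spectralRadius ℂ N < (ρ : ENNReal) :=
    spectrum.spectralRadius_lt_of_forall_lt N fun z hz => h z hz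
  have h2 := (spectrum.pow_nnnorm_pow_one_div_tendsto_nhds_spectralRadius N).eventually_lt_const h1
  filter_upwards [h2, Filter.eventually_ge_atTop 1] with n hn hn1
  have hn0 : (0 : ℝ) < n := by exact_mod_cast hn1
  have h3 : (‖N ^ n‖₊ : ENNReal) ≤ (ρ : ENNReal) ^ n := by
    have := ENNReal.rpow_le_rpow hn.le hn0.le
    rwa [← ENNReal.rpow_mul, one_div, inv_mul_cancel₀ hn0.ne', ENNReal.rpow_one,
      ENNReal.rpow_natCast] at this
  exact_mod_cast h3

/-- If `Q` is a projection commuting with `A` as `A Q = Q A = Q`, and `A - Q` is a finite-rank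
perturbation of `T`, then `A^n - Q` decays at any rate exceeding the spectrum of `T` and the
moduli of the eigenvalues of `A` on `ker Q`. -/
lemma eventually_norm_pow_sub_le {E : Type*} [NormedAddCommGroup E] [NormedSpace ℂ E]
    [CompleteSpace E] [Nontrivial E] {A Q T : E →L[ℂ] E} (h1 : A * Q = Q) (h2 : Q * A = Q)
    (h3 : Q * Q = Q) (Y : Submodule ℂ E) [FiniteDimensional ℂ Y]
    (hY : ∀ x, A x - Q x - T x ∈ Y) {ρ : ℝ} (hρ : 0 < ρ)
    (hT : ∀ z : ℂ, ρ ≤ ‖z‖ → z ∈ resolventSet ℂ T)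
    (heig : ∀ z : ℂ, ρ ≤ ‖z‖ → ∀ x, Q x = 0 → A x = z • x → x = 0) :
    ∀ᶠ n : ℕ in Filter.atTop, ∀ x, ‖(A ^ n) x - Q x‖ ≤ ρ ^ n * ‖x‖ := by
  have hspec : ∀ z ∈ spectrum ℂ (A - Q), ‖z‖ < ρ := by
    intro z hz
    by_contra! hzρ
    obtain ⟨x, hx, hxz⟩ := exists_eigenvector_of_mem_spectrum (hT z hzρ) Y hY hz
    -- Since $Q(A-Q)=0$ and $z\ne0$, an eigenvector of $A-Q$ lies in $\ker Q$, hence is an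
    -- eigenvector of $A$.
    have hQx : Q x = 0 := by
      have e1 : Q ((A - Q) x) = 0 := by
        have : (Q * (A - Q)) x = 0 := by rw [mul_sub, h2, h3, sub_self]; rfl
        exact this
      rw [hxz, map_smul] at e1
      exact (smul_eq_zero.1 e1).resolve_left (norm_pos_iff.1 (hρ.trans_le hzρ))
    rw [sub_apply, hQx, sub_zero] at hxz
    exact hx (heig z hzρ x hQx hxz)
  filter_upwards [eventually_norm_pow_le hρ hspec, Filter.eventually_ge_atTop 1] with n hn hn1 x
  obtain ⟨m, rfl⟩ : ∃ m, n = m + 1 := ⟨n - 1, by omega⟩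
  rw [sub_pow_eq h1 h2 h3] at hn
  exact (ContinuousLinearMap.le_opNorm (A ^ (m + 1) - Q) x).trans
    (mul_le_mul_of_nonneg_right hn (norm_nonneg x))

lemma le_of_eventually_pow_le {x ρ C : ℝ} (hρ : 0 < ρ)
    (h : ∀ᶠ n : ℕ in Filter.atTop, x ^ n ≤ C * ρ ^ n) : x ≤ ρ := by
  by_contra! hlt
  have ht := tendsto_pow_atTop_atTop_of_one_lt ((one_lt_div hρ).2 hlt)
  obtain ⟨n, h1, h2⟩ := (h.and (ht.eventually_gt_atTop C)).exists
  rw [div_pow, lt_div_iff₀ (by positivity)] at h2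
  linarith

end Operators

/-! ### The convergence rate -/

section Rate

open scoped BoundedContinuousFunction

variable {P : ℕ → ℕ → ℝ} {c g d : ℕ} {a : ℤ → ℝ} {γ : ℝ} {π : ℕ → ℝ}

lemma weightBounded_invariant (hγ : 1 ≤ γ) (hπ : ∀ j, 0 ≤ π j)
    (hs : Summable fun n => π n * γ ^ n) :
    WeightBounded γ (fun _ j => π j) (∑' n, π n * γ ^ n) where
  nonneg _ j := hπ j
  summable _ := hs
  tsum_le i := le_mul_of_one_le_right
    (tsum_nonneg fun n => mul_nonneg (hπ n) (pow_nonneg (by linarith) n)) (one_le_pow₀ hγ)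

lemma IsMarkov.act_const (hP : IsMarkov P) (x : ℂ) (i : ℕ) : act P (fun _ => x) i = x := by
  have h : HasSum (fun j => (P i j : ℂ)) 1 := by
    simpa only [Complex.ofReal_one] using Complex.hasSum_ofReal.2 (hP.2 i)
  simpa [act] using (h.mul_right x).tsum_eq

lemma IsInvariantProb.tsum_const (hπ : IsInvariantProb P π) (x : ℂ) :
    ∑' j, (π j : ℂ) * x = x := by
  have h : HasSum (fun j => (π j : ℂ)) 1 := by
    simpa only [Complex.ofReal_one] using Complex.hasSum_ofReal.2 hπ.2.1
  simpa using (h.mul_right x).tsum_eq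

lemma IsInvariantProb.tsum_act (hπ : IsInvariantProb P π) (hγ : 0 ≤ γ) {B : ℝ}
    (hK : WeightBounded γ P B) (hs : Summable fun n => π n * γ ^ n) {f : ℕ → ℂ}
    (hf : f ∈ growth γ) : ∑' i, (π i : ℂ) * act P f i = ∑' j, (π j : ℂ) * f j := by
  rw [hK.tsum_mul_act hγ hπ.1 hs hf]
  exact tsum_congr fun j => by rw [(hπ.2.2 j).tsum_eq]

/-- The eigenvalues of `P` on sequences `O(γ^n)` that lie in the annulus. -/
def annulusEigenvalues (P : ℕ → ℕ → ℝ) (g d : ℕ) (a : ℤ → ℝ) (γ : ℝ) : Set ℂ :=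
  {lam ∈ annulus g d a γ | ∃ f ∈ growth γ, f ≠ 0 ∧ ∀ i, act P f i = lam * f i}

lemma IsInvariantProb.tsum_eq_zero (hπ : IsInvariantProb P π) (hγ : 0 ≤ γ) {B : ℝ}
    (hK : WeightBounded γ P B) (hs : Summable fun n => π n * γ ^ n) {f : ℕ → ℂ}
    (hf : f ∈ growth γ) {lam : ℂ} (hlam : lam ≠ 1) (heig : ∀ i, act P f i = lam * f i) :
    ∑' j, (π j : ℂ) * f j = 0 := by
  have h := hπ.tsum_act hγ hK hs hf
  simp only [heig, mul_left_comm _ lam, tsum_mul_left] at h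
  have h1 : (lam - 1) * ∑' j, (π j : ℂ) * f j = 0 := by rw [sub_mul, h]; ring
  exact (mul_eq_zero.1 h1).resolve_left (sub_ne_zero.2 hlam)

/-- $P-\pi(\cdot)\mathbf 1$ differs from $T$ by an operator with values in the span of the boundary
sequences and $\mathbf 1$. Thus its spectrum in $|z|\ge\rho$ could only come from eigensequences of
$P$ with $\pi$-mean zero, and there are none. -/
lemma IsWalk.mem_rateSet (hP : IsWalk P c g d a) (hirr : IsIrreducible P) (haper : IsAperiodic P)
    (hγ : 1 < γ) (hδ : phi g d a γ < 1) (hπ : IsInvariantProb P π)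
    (hs : Summable fun n => π n * γ ^ n) {ρ : ℝ} (h1 : phi g d a γ < ρ) (h2 : ρ < 1)
    (h3 : ∀ lam ∈ annulusEigenvalues P g d a γ, ‖lam‖ < ρ) :
    ρ ∈ rateSet P π fun n => γ ^ n := by
  have hγ0 : 0 < γ := by linarith
  have hφ := phi_pos hP.a_nonneg hP.a_left hγ0
  have hK := (hP.weightBounded hγ).2
  have hB : 0 ≤ phi g d a γ + γ ^ c := by positivity
  have hKπ := weightBounded_invariant hγ.le hπ.1 hs
  have hBπ : 0 ≤ ∑' n, π n * γ ^ n := tsum_nonneg fun n => mul_nonneg (hπ.1 n) (by positivity)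
  obtain ⟨A, hA⟩ : ∃ A : (ℕ →ᵇ ℂ) →L[ℂ] (ℕ →ᵇ ℂ), ∀ h, toSeq γ (A h) = act P (toSeq γ h) :=
    ⟨kernelOp hγ0 hK hB, toSeq_kernelOp hγ0 hK hB⟩
  obtain ⟨Q, hQ⟩ : ∃ Q : (ℕ →ᵇ ℂ) →L[ℂ] (ℕ →ᵇ ℂ), ∀ h,
      toSeq γ (Q h) = fun _ => ∑' j, (π j : ℂ) * toSeq γ h j :=
    ⟨kernelOp hγ0 hKπ hBπ, toSeq_kernelOp hγ0 hKπ hBπ⟩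
  have hAQ : A * Q = Q := by
    ext1 h
    refine toSeq_injective hγ0 ?_
    rw [mul_apply_eq_comp, hA, hQ]
    ext i
    exact hP.markov.act_const _ i
  have hQA : Q * A = Q := by
    ext1 h
    refine toSeq_injective hγ0 ?_
    rw [mul_apply_eq_comp, hQ, hQ, hA]
    ext i
    exact hπ.tsum_act hγ0.le hK hs (toSeq_mem_growth hγ0 h)
  have hQQ : Q * Q = Q := by
    ext1 h
    refine toSeq_injective hγ0 ?_
    rw [mul_apply_eq_comp, hQ, hQ]
    ext i
    exact hπ.tsum_const _
  obtain ⟨u, hu, -⟩ : ∃ u : ℕ →ᵇ ℂ, toSeq γ u = (fun _ => 1) ∧ ‖u‖ ≤ 1 :=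
    exists_toSeq_eq hγ0 fun n => by simpa using one_le_pow₀ hγ.le
  set Y : Submodule ℂ (ℕ →ᵇ ℂ) := Submodule.span ℂ
    (insert u (Set.range fun j : Fin g => initial γ (Pi.single j (1 : ℂ))))
  have hYfin : FiniteDimensional ℂ Y :=
    FiniteDimensional.span_of_finite ℂ ((Set.finite_range _).insert u)
  have hY : ∀ h, A h - Q h - hP.interiorOp hγ0 h ∈ Y := by
    intro h
    have e : A h - Q h - hP.interiorOp hγ0 h =
        initial γ (fun i : Fin g => act P (toSeq γ h) i) -
          (∑' j, (π j : ℂ) * toSeq γ h j) • u := by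
      refine toSeq_injective hγ0 ?_
      ext i
      rw [map_sub, map_sub, map_sub, map_smul, hA, hQ, hu, Pi.sub_apply, Pi.sub_apply,
        Pi.sub_apply, hP.toSeq_interiorOp, toSeq_initial hγ0, Pi.smul_apply, smul_eq_mul, mul_one]
      rcases lt_or_ge i g with hi | hi
      · rw [if_neg (by omega), dif_pos hi, sub_zero]
      · rw [if_pos hi, dif_neg (by omega)]
        ring
    rw [e]
    refine Y.sub_mem ?_ (Y.smul_mem _ (Submodule.subset_span (Set.mem_insert _ _)))
    rw [initial_eq_sum]
    exact Y.sum_mem fun j _ => Y.smul_mem _ (Submodule.subset_span (Or.inr ⟨j, rfl⟩))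
  have heig : ∀ z : ℂ, ρ ≤ ‖z‖ → ∀ h, Q h = 0 → A h = z • h → h = 0 := by
    intro z hzρ h hQh hAh
    by_contra hne
    have hf : toSeq γ h ∈ growth γ := toSeq_mem_growth hγ0 h
    have hf0 : toSeq γ h ≠ 0 := fun h0 => hne (toSeq_injective hγ0 (h0.trans (map_zero _).symm))
    have hmean : ∑' j, (π j : ℂ) * toSeq γ h j = 0 := by
      have := congrFun (hQ h) 0
      rw [hQh, map_zero] at this
      exact this.symm
    have heig : ∀ i, act P (toSeq γ h) i = z * toSeq γ h i := by
      intro i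
      rw [← hA, hAh, map_smul, Pi.smul_apply, smul_eq_mul]
    rcases lt_or_ge ‖z‖ 1 with hz1 | hz1
    · exact absurd (h3 z ⟨⟨h1.trans_le hzρ, hz1⟩, _, hf, hf0, heig⟩) (not_lt.2 hzρ)
    · obtain ⟨-, x, hx, hfx⟩ := hP.peripheral hirr haper hγ hδ hz1 hf heig hf0
      simp only [hfx] at hmean
      rw [hπ.tsum_const] at hmean
      exact hx hmean
  have hpow := eventually_norm_pow_sub_le hAQ hQA hQQ Y hY (hφ.trans h1)
    (fun z hz => hP.mem_resolventSet hγ0 (h1.trans_le hz)) heig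
  refine ⟨hφ.trans h1, h2, 1, ?_⟩
  filter_upwards [hpow] with n hn
  intro f hf i
  obtain ⟨h, rfl, hh⟩ := exists_toSeq_eq hγ0 (f := f) (C := 1) (fun i => by simpa using hf i)
  have hiter : ∀ k, toSeq γ ((A ^ k) h) = (act P)^[k] (toSeq γ h) := fun k => by
    induction k with
    | zero => rfl
    | succ k ih => rw [pow_succ', mul_apply_eq_comp, hA, ih, Function.iterate_succ_apply']
  have e : (act P)^[n] (toSeq γ h) i - ∑' j, (π j : ℂ) * toSeq γ h j =
      toSeq γ ((A ^ n) h - Q h) i := by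
    rw [map_sub, hiter, hQ, Pi.sub_apply]
  rw [e]
  refine (norm_toSeq_le hγ0 _ i).trans (mul_le_mul_of_nonneg_right ?_ (by positivity))
  refine (hn h).trans ?_
  rw [one_mul]
  exact mul_le_of_le_one_right (pow_nonneg (hφ.trans h1).le n) hh

/-- Starting from $i\ge ng$, the first $n$ jumps all use interior rows, so $\gamma^i$ behaves as an
exact eigensequence. -/
lemma IsWalk.iterate_act_weight (hP : IsWalk P c g d a) (hγ : 0 < γ) (n : ℕ) :
    ∀ i, n * g ≤ i → (act P)^[n] (fun j => (γ : ℂ) ^ j) i = (phi g d a γ : ℂ) ^ n * (γ : ℂ) ^ i := by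
  induction n with
  | zero => intro i _; simp
  | succ n ih =>
    intro i hi
    rw [Nat.succ_mul] at hi
    have hγ' : (γ : ℂ) ≠ 0 := Complex.ofReal_ne_zero.2 hγ.ne'
    rw [Function.iterate_succ_apply', hP.act_interior _ (by omega : g ≤ i), pow_succ]
    have hφ : (phi g d a γ : ℂ) =
        ∑ k ∈ Finset.Icc (-(g : ℤ)) d, (a k : ℂ) * (γ : ℂ) ^ k := by
      rw [phi]; push_cast; rfl
    rw [mul_assoc, hφ, Finset.sum_mul, Finset.mul_sum]
    refine Finset.sum_congr rfl fun k hk => ?_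
    rw [Finset.mem_Icc] at hk
    rw [ih _ (by omega), ← hφ]
    have e : (γ : ℂ) ^ ((i : ℤ) + k).toNat = (γ : ℂ) ^ k * (γ : ℂ) ^ i := by
      rw [← zpow_natCast, ← zpow_natCast, ← zpow_add₀ hγ']
      congr 1
      omega
    rw [e]
    ring

/-- Test on the weight itself, of norm $1$. For fixed $n$ let $i\to\infty$: the term
$\pi(f)/\gamma^i$ disappears and $\varphi(\gamma)^n\le C\rho^n$ remains. -/
lemma IsWalk.phi_le_of_mem_rateSet (hP : IsWalk P c g d a) (hγ : 1 < γ) {ρ : ℝ}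
    (hρ : ρ ∈ rateSet P π fun n => γ ^ n) : phi g d a γ ≤ ρ := by
  have hγ0 : 0 < γ := by linarith
  have hφ := phi_pos hP.a_nonneg hP.a_left hγ0
  obtain ⟨hρ0, -, C, hC⟩ := hρ
  refine le_of_eventually_pow_le hρ0 (C := C) ?_
  filter_upwards [hC] with n hn
  set m := ∑' j, (π j : ℂ) * (γ : ℂ) ^ j
  have hb : ∀ i, n * g ≤ i → phi g d a γ ^ n - ‖m‖ * (γ ^ i)⁻¹ ≤ C * ρ ^ n := by
    intro i hi
    have h1 := hn (fun j => (γ : ℂ) ^ j) (fun j => by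
      rw [norm_pow, Complex.norm_real, Real.norm_of_nonneg hγ0.le]) i
    rw [hP.iterate_act_weight hγ0 n i hi] at h1
    have h2 := norm_sub_norm_le ((phi g d a γ : ℂ) ^ n * (γ : ℂ) ^ i) m
    rw [norm_mul, norm_pow, norm_pow, Complex.norm_real, Complex.norm_real,
      Real.norm_of_nonneg hγ0.le, Real.norm_of_nonneg hφ.le] at h2
    have h3 : phi g d a γ ^ n * γ ^ i - ‖m‖ ≤ C * ρ ^ n * γ ^ i := h2.trans h1
    have hpos : 0 < γ ^ i := by positivity
    rw [← mul_le_mul_iff_left₀ hpos, sub_mul, mul_assoc ‖m‖, inv_mul_cancel₀ hpos.ne', mul_one]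
    exact h3
  have hlim : Filter.Tendsto (fun i : ℕ => phi g d a γ ^ n - ‖m‖ * (γ ^ i)⁻¹) Filter.atTop
      (nhds (phi g d a γ ^ n)) := by
    have := (tendsto_inv_atTop_zero.comp (tendsto_pow_atTop_atTop_of_one_lt hγ)).const_mul ‖m‖
    simpa using this.const_sub (phi g d a γ ^ n)
  exact le_of_tendsto hlim (Filter.eventually_atTop.2 ⟨n * g, hb⟩)

/-- Test on an eigensequence, normalized by its growth constant. As $\lambda\ne1$, invariance gives
$\pi(f)=0$, so $|\lambda|^n$ appears directly. -/
lemma IsWalk.norm_le_of_mem_rateSet (hP : IsWalk P c g d a) (hγ : 1 < γ)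
    (hπ : IsInvariantProb P π) (hs : Summable fun n => π n * γ ^ n) {ρ : ℝ}
    (hρ : ρ ∈ rateSet P π fun n => γ ^ n) {lam : ℂ} (hlam : lam ∈ annulusEigenvalues P g d a γ) :
    ‖lam‖ ≤ ρ := by
  have hγ0 : 0 < γ := by linarith
  obtain ⟨hann, f, hf, hne, heig⟩ := hlam
  have hlam1 : lam ≠ 1 := fun h => by
    have := hann.2
    rw [h, norm_one] at this
    exact lt_irrefl _ this
  have hmean := hπ.tsum_eq_zero hγ0.le (hP.weightBounded hγ).2 hs hf hlam1 heig
  obtain ⟨D, hD⟩ := hf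
  obtain ⟨i, hi⟩ : ∃ i, f i ≠ 0 := Function.ne_iff.1 hne
  have hfi : 0 < ‖f i‖ := norm_pos_iff.2 hi
  have hDpos : 0 < D := by
    have := hfi.trans_le (hD i)
    exact pos_of_mul_pos_left this (by positivity)
  obtain ⟨hρ0, -, C, hC⟩ := hρ
  refine le_of_eventually_pow_le hρ0 (C := C * γ ^ i * D / ‖f i‖) ?_
  filter_upwards [hC] with n hn
  have hiter : ∀ k, (act P)^[k] ((D : ℂ)⁻¹ • f) = (lam ^ k * (D : ℂ)⁻¹) • f := fun k => by
    induction k with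
    | zero => simp
    | succ k ih =>
      rw [Function.iterate_succ_apply', ih, act_smul]
      ext j
      rw [Pi.smul_apply, Pi.smul_apply, heig, smul_eq_mul, smul_eq_mul]
      ring
  have h1 := hn ((D : ℂ)⁻¹ • f) (fun j => by
    rw [Pi.smul_apply, norm_smul, norm_inv, Complex.norm_real, Real.norm_of_nonneg hDpos.le,
      inv_mul_le_iff₀ hDpos]
    exact hD j) i
  have h2 : ∑' j, (π j : ℂ) * ((D : ℂ)⁻¹ • f) j = 0 := by
    simp only [Pi.smul_apply, smul_eq_mul, mul_left_comm _ (D : ℂ)⁻¹, tsum_mul_left, hmean,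
      mul_zero]
  rw [h2, sub_zero, hiter, Pi.smul_apply, norm_smul, norm_mul, norm_pow, norm_inv,
    Complex.norm_real, Real.norm_of_nonneg hDpos.le] at h1
  rw [div_mul_eq_mul_div, le_div_iff₀ hfi]
  calc ‖lam‖ ^ n * ‖f i‖ = (‖lam‖ ^ n * D⁻¹ * ‖f i‖) * D := by field_simp
    _ ≤ (C * ρ ^ n * γ ^ i) * D := mul_le_mul_of_nonneg_right h1 hDpos.le
    _ = C * γ ^ i * D * ρ ^ n := by ring

/-- Geometric ergodicity implies uniqueness of the invariant probability measure. -/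
lemma IsMarkov.eq_of_rateSet_nonempty (hP : IsMarkov P) (hγ : 1 < γ)
    (hne : (rateSet P π fun n => γ ^ n).Nonempty) {π' : ℕ → ℝ} (hπ' : IsInvariantProb P π') :
    π' = π := by
  have hγ0 : 0 < γ := by linarith
  obtain ⟨ρ, hρ0, hρ1, C, hC⟩ := hne
  -- The competitor $\pi'$ is not known to integrate $\gamma^n$, so duality is used with weight $1$.
  -- For the indicator $e$ of $j$, $\pi'(P^ne)=\pi'(j)$ for all $n$, while $P^ne\to\pi(j)$
  -- pointwise, dominated by $1$.
  have hK := IsWalk.weightBounded_one hP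
  have hs' : Summable fun n => π' n * 1 ^ n := by simpa using hπ'.2.1.summable
  ext j
  set e : ℕ → ℂ := fun n => if n = j then 1 else 0
  set F : ℕ → ℕ → ℂ := fun n => (act P)^[n] e
  have hF1 : ∀ n i, ‖F n i‖ ≤ 1 * 1 ^ i := by
    intro n
    induction n with
    | zero =>
      intro i
      simp only [F, e, Function.iterate_zero, id]
      split_ifs <;> simp
    | succ n ih =>
      intro i
      simp only [F, Function.iterate_succ_apply']
      simpa using hK.norm_act_le zero_le_one ih i
  have hFsum : ∀ n, ∑' i, (π' i : ℂ) * F n i = π' j := by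
    intro n
    induction n with
    | zero =>
      rw [tsum_eq_single j fun i hi => by simp [F, e, hi]]
      simp [F, e]
    | succ n ih =>
      rw [← ih, ← hπ'.tsum_act zero_le_one hK hs' ⟨1, hF1 n⟩]
      simp only [F, Function.iterate_succ_apply']
  have hlim : ∀ i, Filter.Tendsto (fun n => F n i) Filter.atTop (nhds (π j : ℂ)) := by
    intro i
    rw [tendsto_iff_norm_sub_tendsto_zero]
    have h0 : Filter.Tendsto (fun n : ℕ => C * ρ ^ n * γ ^ i) Filter.atTop (nhds 0) := by
      simpa using ((tendsto_pow_atTop_nhds_zero_of_lt_one hρ0.le hρ1).const_mul C).mul_const (γ ^ i)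
    refine squeeze_zero' (Filter.Eventually.of_forall fun n => norm_nonneg _) ?_ h0
    filter_upwards [hC] with n hn
    have h1 := hn e (fun k => by
      simp only [e]
      split_ifs
      · simpa using one_le_pow₀ hγ.le
      · simpa using (by positivity : 0 ≤ γ ^ k)) i
    rwa [tsum_eq_single j fun i hi => by simp [e, hi], show e j = 1 by simp [e], mul_one] at h1
  have hdom := tendsto_tsum_of_dominated_convergence (f := fun n i => (π' i : ℂ) * F n i)
    (g := fun i => (π' i : ℂ) * (π j : ℂ)) (bound := π') (𝓕 := Filter.atTop) hπ'.2.1.summable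
    (fun i => (hlim i).const_mul _) (Filter.Eventually.of_forall fun n i => by
      rw [norm_mul, Complex.norm_real, Real.norm_of_nonneg (hπ'.1 i)]
      exact mul_le_of_le_one_right (hπ'.1 i) (by simpa using hF1 n i))
  simp only [hFsum, hπ'.tsum_const] at hdom
  exact_mod_cast tendsto_nhds_unique tendsto_const_nhds hdom

/-- The convergence rate is the largest modulus among `φ(γ)` and the eigenvalues in the annulus. -/
lemma IsWalk.isGreatest_rate (hP : IsWalk P c g d a) (hirr : IsIrreducible P)
    (haper : IsAperiodic P) (hγ : 1 < γ) (hδ : phi g d a γ < 1) (hπ : IsInvariantProb P π)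
    (hs : Summable fun n => π n * γ ^ n) :
    (rateSet P π fun n => γ ^ n).Nonempty ∧
      IsGreatest (insert (phi g d a γ) ((fun lam : ℂ => ‖lam‖) '' annulusEigenvalues P g d a γ))
        (rate P π fun n => γ ^ n) := by
  set S := insert (phi g d a γ) ((fun lam : ℂ => ‖lam‖) '' annulusEigenvalues P g d a γ)
  have hfin : (annulusEigenvalues P g d a γ).Finite :=
    (hP.finite_eigenvalues hirr haper hγ hδ).subset fun lam h => ⟨h.1.1, h.2⟩
  -- Finiteness makes the supremum of the moduli attained, hence strictly below $1$; there is then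
  -- room for admissible rates just above it.
  have hSfin : S.Finite := (hfin.image _).insert _
  obtain ⟨r, hrS, hmax⟩ := hSfin.exists_maximal ⟨phi g d a γ, Set.mem_insert _ _⟩
  have hr : ∀ x ∈ S, x ≤ r := fun x hx => (le_total x r).elim id fun h => hmax hx h
  have hr1 : r < 1 := by
    rcases hrS with rfl | ⟨lam, hlam, rfl⟩
    · exact hδ
    · exact hlam.1.2
  have hmem : ∀ ρ, r < ρ → ρ < 1 → ρ ∈ rateSet P π fun n => γ ^ n := fun ρ h1 h2 =>
    hP.mem_rateSet hirr haper hγ hδ hπ hs ((hr _ (Set.mem_insert _ _)).trans_lt h1) h2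
      fun lam hlam => (hr _ (Or.inr ⟨lam, hlam, rfl⟩)).trans_lt h1
  have hne : (rateSet P π fun n => γ ^ n).Nonempty := by
    obtain ⟨ρ, h1, h2⟩ := exists_between hr1
    exact ⟨ρ, hmem ρ h1 h2⟩
  have hlb : ∀ ρ ∈ rateSet P π fun n => γ ^ n, r ≤ ρ := by
    intro ρ hρ
    rcases hrS with rfl | ⟨lam, hlam, rfl⟩
    · exact hP.phi_le_of_mem_rateSet hγ hρ
    · exact hP.norm_le_of_mem_rateSet hγ hπ hs hρ hlam
  have hrate : rate P π (fun n => γ ^ n) = r := by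
    refine le_antisymm ?_ (le_csInf hne hlb)
    refine le_of_forall_gt_imp_ge_of_dense fun x hx => ?_
    obtain ⟨ρ, h1, h2⟩ := exists_between (lt_min hx hr1)
    exact (csInf_le ⟨r, hlb⟩ (hmem ρ h1 (h2.trans_le (min_le_right _ _)))).trans
      (h2.le.trans (min_le_left _ _))
  rw [hrate]
  exact ⟨hne, hrS, hr⟩

end Rate

end RW

end

theorem corollary2 (P : ℕ → ℕ → ℝ) (c g d : ℕ) (a : ℤ → ℝ)
    (hP : RW.IsWalk P c g d a)
    (hneri : ∑ k ∈ Finset.Icc (-(g : ℤ)) d, (k : ℝ) * a k < 0)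
    (hirr : RW.IsIrreducible P) (haper : RW.IsAperiodic P) :
    ∃ (γ : ℝ) (π : ℕ → ℝ) (η : ℕ),
      (RW.IsMinimizer g d a γ ∧ ∀ γ', RW.IsMinimizer g d a γ' → γ' = γ) ∧
      RW.phi g d a γ < 1 ∧
      (RW.IsInvariantProb P π ∧ ∀ π', RW.IsInvariantProb P π' → π' = π) ∧
      (Summable fun n : ℕ => π n * γ ^ n) ∧
      1 ≤ η ∧
      (∀ lam ∈ RW.annulus g d a γ, RW.numSmall g d a γ lam = η) ∧
      (RW.candidates P c g d a γ η).Finite ∧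
      (RW.rateSet P π fun n => γ ^ n).Nonempty ∧
      IsGreatest
        (insert (RW.phi g d a γ) ((fun lam : ℂ => ‖lam‖) '' RW.candidates P c g d a γ η))
        (RW.rate P π fun n => γ ^ n) := by
  obtain ⟨γ, hmin, hδ⟩ := RW.exists_isMinimizer hP.d_pos hP.a_nonneg hP.a_right hP.a_sum hneri
  have hγ : 1 < γ := hmin.1
  have hγ0 : 0 < γ := by linarith
  obtain ⟨π, hπ, hs⟩ := hP.exists_invariant hγ hδ
  obtain ⟨hne, hgreat⟩ := hP.isGreatest_rate hirr haper hγ hδ hπ hs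
  have hcand : RW.candidates P c g d a γ g = RW.annulusEigenvalues P g d a γ :=
    hP.candidates_eq hγ0
  -- The common number of small roots is $g$ itself.
  refine ⟨γ, π, g, ⟨hmin, fun γ' h => hmin.eq hP.g_pos hP.a_nonneg hP.a_left h⟩, hδ,
    ⟨hπ, fun π' h => hP.markov.eq_of_rateSet_nonempty hγ hne h⟩, hs, hP.g_pos,
    fun lam hlam => hP.numSmall_eq hγ0 hlam.1, ?_, hne, ?_⟩
  · rw [hcand]
    exact (hP.finite_eigenvalues hirr haper hγ hδ).subset fun lam h => ⟨h.1.1, h.2⟩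
  · rw [hcand]
    exact hgreat
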